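/- Consider states (density matrices) $\rho=\rho^{ABC}$ of three qubits. For a tripartite state $\rho^{ABC}$ let $$\mathcal F_{\mathrm{PPT}}(\rho)=\sup F(\sigma_f,\sigma_t),\qquad F(\rho,\sigma)=\mathrm{Tr}\,(\sqrt\rho\,\sigma\sqrt\rho)^{1/2},$$ where $\sigma_t^{ACR}$ is $\rho^{ABC}$ with $B$ relabelled as $R$, $\sigma_f^{ACR}=\mathrm{Tr}_B\,\Lambda_{\mathrm{PPT}}[\rho^{ABC}\otimes\kappa^R]$, and the supremum is over all states $\kappa$ of Charlie's register $R$ and all PPT assisted LOCC operations $\Lambda_{\mathrm{PPT}}[\tau]=\mathrm{Tr}_{\tilde B\tilde C}\Lambda_{\mathrm{LOCC}}[\tau\otimes\mu^{\tilde B\tilde C}]$ between Bob ($B$) and Charlie ($CR$), with $\mu^{\tilde B\tilde C}$ any finite-dimensional state with positive partial transpose. Let $\mathcal F^\infty_{\mathrm{PPT}}(\rho)=\lim_{n\to\infty}\mathcal F_{\mathrm{PPT}}(\rho^{\otimes n})$. Let $D_{\mathrm{LOCC}}^{A:BC}$ be the distillable entanglement between $A$ and $BC$ (the supremum of the rates at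 which singlets can be distilled asymptotically by LOCC); $\rho$ is called distillable across $A{:}BC$ if $D_{\mathrm{LOCC}}^{A:BC}(\rho)>0$. Let $E_n^{AB:C}(\rho)=\log_2\|\rho^{T_C}\|_1$ be the logarithmic negativity. Then: 1. The set of three-qubit states $\rho$ for which $\mathcal F^\infty_{\mathrm{PPT}}(\rho)$ exists and equals $0$ has nonzero (Lebesgue) measure in the 63-dimensional real affine space of Hermitian $8\times 8$ matrices of trace one. 2. For $p\in(0,1]$ let $\rho_p=(1-p)\,|\phi^+\rangle\langle\phi^+|^{AB}\otimes|0\rangle\langle0|^C+p\,\mathbb 1/8$ with $|\phi^+\rangle=(|00\rangle+|11\rangle)/\sqrt2$. (a) There is $p_{\max}\in(0,1]$ such that $\rho_p$ is distillable across $A{:}BC$ for all $0<p<p_{\max}$. (b) For every $p\in(0,1]$, $\rho_p$ is a state and lies in the interior, relative to the Hermitian matrices of trace one, of the set of states that are separable across $AB{:}C$. (c) For every $p\in(0,1]$ such that $\rho_p$ is distillable across $A{:}BC$, all Hermitian matrices $\sigma$ of trace one in some neighbourhood of $\rho_p$ are states with $$D_{\mathrm{LOCC}}^{A:BC}(\sigma)>E_n^{AB:C}(\sigma)=0\qquad\text{and}\qquad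 \mathcal F^\infty_{\mathrm{PPT}}(\sigma)=0 .$$ -/

import Mathlib

open Filter MeasureTheory
open scoped Matrix Kronecker Topology ENNReal NNReal ComplexOrder

noncomputable section

namespace PQSM

/-! ## States and basic functions of states -/

/-- Density matrices. A composite system has a product type as its index type. -/
structure IsDensity {n : Type} [Fintype n] (ρ : Matrix n n ℂ) : Prop where
  posSemidef : ρ.PosSemidef
  trace_eq_one : ρ.trace = 1

/-- Square root of a positive semidefinite matrix. -/
def msqrt {n : Type} [Fintype n] [DecidableEq n] (M : Matrix n n ℂ) : Matrix n n ℂ :=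
  cfc Real.sqrt M

/-- Trace norm `Tr √(M† M)`. -/
def traceNorm {n : Type} [Fintype n] [DecidableEq n] (M : Matrix n n ℂ) : ℝ :=
  (msqrt (Mᴴ * M)).trace.re

/-- Trace distance `‖ρ - σ‖ / 2`. -/
def traceDist {n : Type} [Fintype n] [DecidableEq n] (ρ σ : Matrix n n ℂ) : ℝ :=
  traceNorm (ρ - σ) / 2

/-- Fidelity `F(ρ, σ) = Tr (√ρ σ √ρ)^{1/2}`. -/
def fidelity {n : Type} [Fintype n] [DecidableEq n] (ρ σ : Matrix n n ℂ) : ℝ :=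
  (msqrt (msqrt ρ * σ * msqrt ρ)).trace.re

/-! ## Bipartite systems -/

/-- Partial transposition of the second party. -/
def partialTranspose {X Y : Type} (τ : Matrix (X × Y) (X × Y) ℂ) : Matrix (X × Y) (X × Y) ℂ :=
  Matrix.of fun i j => τ (i.1, j.2) (j.1, i.2)

/-- Positive partial transpose. -/
def IsPPT {X Y : Type} (τ : Matrix (X × Y) (X × Y) ℂ) : Prop :=
  (partialTranspose τ).PosSemidef

/-- Logarithmic negativity. -/
def logNegativity {X Y : Type} [Fintype X] [DecidableEq X] [Fintype Y] [DecidableEq Y]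
    (τ : Matrix (X × Y) (X × Y) ℂ) : ℝ :=
  Real.logb 2 (traceNorm (partialTranspose τ))

/-- Separable states: convex combinations of product states. -/
def separableStates (X Y : Type) [Fintype X] [Fintype Y] : Set (Matrix (X × Y) (X × Y) ℂ) :=
  convexHull ℝ {τ | ∃ (α : Matrix X X ℂ) (β : Matrix Y Y ℂ),
    IsDensity α ∧ IsDensity β ∧ τ = α ⊗ₖ β}

/-- The `n`-fold tensor power of a bipartite operator, as an operator on the `n` copies of the
first party and the `n` copies of the second party. -/
def tensorPow₂ {X Y : Type} (τ : Matrix (X × Y) (X × Y) ℂ) (n : ℕ) :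
    Matrix ((Fin n → X) × (Fin n → Y)) ((Fin n → X) × (Fin n → Y)) ℂ :=
  Matrix.of fun x y => ∏ i, τ (x.1 i, x.2 i) (y.1 i, y.2 i)

/-- `|φ⁺⟩⟨φ⁺|` with `|φ⁺⟩ = (|00⟩ + |11⟩) / √2`. -/
def phiPlus : Matrix (Fin 2 × Fin 2) (Fin 2 × Fin 2) ℂ :=
  Matrix.of fun i j => if i.1 = i.2 ∧ j.1 = j.2 then 1 / 2 else 0

/-! ## LOCC -/

/-- `IsLOCC Λ`: the map `Λ`, from operators on `X : Y` to operators on `X' : Y'`, is realised by a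
protocol with finitely many rounds of local operations and classical communication.
Either nothing is done, or one party applies a measurement with Kraus operators `K k`
(with an output system `Z k` that may depend on the outcome `k`), the outcome is announced, and the
parties go on with an LOCC protocol that depends on `k`; at the end all outcomes are summed up.
Channels, ancillas, shared randomness, and instruments whose elements have several Kraus operators
arise by ignoring a part of the outcome. -/
inductive IsLOCC {X' Y' : Type} [Fintype X'] [DecidableEq X'] [Fintype Y'] [DecidableEq Y'] :
    ∀ {X Y : Type} [Fintype X] [DecidableEq X] [Fintype Y] [DecidableEq Y],
      (Matrix (X × Y) (X × Y) ℂ → Matrix (X' × Y') (X' × Y') ℂ) → Prop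
  | nil : IsLOCC (fun τ : Matrix (X' × Y') (X' × Y') ℂ => τ)
  | left {X Y : Type} [Fintype X] [DecidableEq X] [Fintype Y] [DecidableEq Y]
      {m : ℕ} {Z : Fin m → Type} [∀ k, Fintype (Z k)] [∀ k, DecidableEq (Z k)]
      (K : ∀ k, Matrix (Z k) X ℂ) (hK : ∑ k, (K k)ᴴ * K k = 1)
      (Λ : ∀ k, Matrix (Z k × Y) (Z k × Y) ℂ → Matrix (X' × Y') (X' × Y') ℂ)
      (hΛ : ∀ k, IsLOCC (Λ k)) :
      IsLOCC (fun τ : Matrix (X × Y) (X × Y) ℂ =>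
        ∑ k, Λ k ((K k ⊗ₖ (1 : Matrix Y Y ℂ)) * τ * (K k ⊗ₖ (1 : Matrix Y Y ℂ))ᴴ))
  | right {X Y : Type} [Fintype X] [DecidableEq X] [Fintype Y] [DecidableEq Y]
      {m : ℕ} {Z : Fin m → Type} [∀ k, Fintype (Z k)] [∀ k, DecidableEq (Z k)]
      (K : ∀ k, Matrix (Z k) Y ℂ) (hK : ∑ k, (K k)ᴴ * K k = 1)
      (Λ : ∀ k, Matrix (X × Z k) (X × Z k) ℂ → Matrix (X' × Y') (X' × Y') ℂ)
      (hΛ : ∀ k, IsLOCC (Λ k)) :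
      IsLOCC (fun τ : Matrix (X × Y) (X × Y) ℂ =>
        ∑ k, Λ k (((1 : Matrix X X ℂ) ⊗ₖ K k) * τ * ((1 : Matrix X X ℂ) ⊗ₖ K k)ᴴ))

/-- `r` is an achievable rate for distilling singlets from `τ` by LOCC between the two parties. -/
def IsDistillationRate {X Y : Type} [Fintype X] [DecidableEq X] [Fintype Y] [DecidableEq Y]
    (τ : Matrix (X × Y) (X × Y) ℂ) (r : ℝ≥0) : Prop :=
  ∃ Λ : ∀ n : ℕ, Matrix ((Fin n → X) × (Fin n → Y)) ((Fin n → X) × (Fin n → Y)) ℂ →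
      Matrix ((Fin ⌊n * r⌋₊ → Fin 2) × (Fin ⌊n * r⌋₊ → Fin 2))
        ((Fin ⌊n * r⌋₊ → Fin 2) × (Fin ⌊n * r⌋₊ → Fin 2)) ℂ,
    (∀ n, IsLOCC (Λ n)) ∧
    Tendsto (fun n : ℕ => traceDist (Λ n (tensorPow₂ τ n)) (tensorPow₂ phiPlus ⌊n * r⌋₊))
      atTop (𝓝 0)

/-- Distillable entanglement `D_LOCC`, the supremum of the achievable rates. -/
def distillableEntanglement {X Y : Type} [Fintype X] [DecidableEq X] [Fintype Y] [DecidableEq Y]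
    (τ : Matrix (X × Y) (X × Y) ℂ) : ℝ≥0∞ :=
  ⨆ (r : ℝ≥0) (_ : IsDistillationRate τ r), (r : ℝ≥0∞)

/-- The joint state `τ ⊗ μ` of the systems `X : Y` and `S : T`, where the first party holds `X`, `S`
and the second party holds `Y`, `T`. -/
def withAncilla {X Y S T : Type} (τ : Matrix (X × Y) (X × Y) ℂ) (μ : Matrix (S × T) (S × T) ℂ) :
    Matrix ((X × S) × (Y × T)) ((X × S) × (Y × T)) ℂ :=
  Matrix.of fun i j => τ (i.1.1, i.2.1) (j.1.1, j.2.1) * μ (i.1.2, i.2.2) (j.1.2, j.2.2)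

/-- Partial trace over the ancillas `S` and `T`. -/
def traceAncilla {X Y S T : Type} [Fintype S] [Fintype T]
    (ω : Matrix ((X × S) × (Y × T)) ((X × S) × (Y × T)) ℂ) : Matrix (X × Y) (X × Y) ℂ :=
  Matrix.of fun i j => ∑ s, ∑ t, ω ((i.1, s), (i.2, t)) ((j.1, s), (j.2, t))

/-- PPT assisted LOCC: the two parties add some PPT state `μ` of any finite dimension, perform an
LOCC protocol, and discard the systems that carried `μ`. -/
def IsPPTAssistedLOCC {X Y : Type} [Fintype X] [DecidableEq X] [Fintype Y] [DecidableEq Y]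
    (Θ : Matrix (X × Y) (X × Y) ℂ → Matrix (X × Y) (X × Y) ℂ) : Prop :=
  ∃ (s t : ℕ) (μ : Matrix (Fin s × Fin t) (Fin s × Fin t) ℂ)
    (Λ : Matrix ((X × Fin s) × (Y × Fin t)) ((X × Fin s) × (Y × Fin t)) ℂ →
      Matrix ((X × Fin s) × (Y × Fin t)) ((X × Fin s) × (Y × Fin t)) ℂ),
    IsDensity μ ∧ IsPPT μ ∧ IsLOCC Λ ∧ ∀ τ, Θ τ = traceAncilla (Λ (withAncilla τ μ))

/-! ## Merging -/

/-- `id ⊗ Θ`: the map `Θ` applied to the second factor, `A` being a spectator. -/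
def idTensor (A : Type) {W W' : Type} (Θ : Matrix W W ℂ → Matrix W' W' ℂ)
    (ω : Matrix (A × W) (A × W) ℂ) : Matrix (A × W') (A × W') ℂ :=
  Matrix.of fun i j => Θ (Matrix.of fun w v => ω (i.1, w) (j.1, v)) i.2 j.2

variable {A B C : Type}

/-- `ρ^{ABC} ⊗ κ^R`, where Charlie holds `C` and the register `R`, a copy of the system `B`. -/
def withRegister (ρ : Matrix (A × B × C) (A × B × C) ℂ) (κ : Matrix B B ℂ) :
    Matrix (A × B × (C × B)) (A × B × (C × B)) ℂ :=
  Matrix.of fun i j => ρ (i.1, i.2.1, i.2.2.1) (j.1, j.2.1, j.2.2.1) * κ i.2.2.2 j.2.2.2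

/-- Partial trace over Bob's system. -/
def traceBob {D : Type} [Fintype B] (ω : Matrix (A × B × D) (A × B × D) ℂ) :
    Matrix (A × D) (A × D) ℂ :=
  Matrix.of fun i j => ∑ b, ω (i.1, b, i.2) (j.1, b, j.2)

/-- The target state on `A`, `C`, `R`: the state `ρ` with `B` relabelled as `R`. -/
def targetState (ρ : Matrix (A × B × C) (A × B × C) ℂ) :
    Matrix (A × (C × B)) (A × (C × B)) ℂ :=
  Matrix.of fun i j => ρ (i.1, i.2.2, i.2.1) (j.1, j.2.2, j.2.1)

/-- Fidelity of PPT quantum state merging: the supremum of the fidelity between the final and the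
target state over all initial states `κ` of the register and all PPT assisted LOCC operations `Θ`
between Bob (`B`) and Charlie (`CR`). -/
def mergingFidelity [Fintype A] [DecidableEq A] [Fintype B] [DecidableEq B] [Fintype C]
    [DecidableEq C] (ρ : Matrix (A × B × C) (A × B × C) ℂ) : ℝ :=
  sSup {f : ℝ | ∃ (κ : Matrix B B ℂ)
    (Θ : Matrix (B × (C × B)) (B × (C × B)) ℂ → Matrix (B × (C × B)) (B × (C × B)) ℂ),
    IsDensity κ ∧ IsPPTAssistedLOCC Θ ∧
    f = fidelity (traceBob (idTensor A Θ (withRegister ρ κ))) (targetState ρ)}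

/-- The `n`-fold tensor power of a tripartite operator. -/
def tensorPow₃ (ρ : Matrix (A × B × C) (A × B × C) ℂ) (n : ℕ) :
    Matrix ((Fin n → A) × (Fin n → B) × (Fin n → C)) ((Fin n → A) × (Fin n → B) × (Fin n → C)) ℂ :=
  Matrix.of fun x y => ∏ i, ρ (x.1 i, x.2.1 i, x.2.2 i) (y.1 i, y.2.1 i, y.2.2 i)

/-- The asymptotic fidelity of PPT quantum state merging of `ρ` exists and equals `l`. -/
def HasAsymptoticFidelity [Fintype A] [DecidableEq A] [Fintype B] [DecidableEq B] [Fintype C]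
    [DecidableEq C] (ρ : Matrix (A × B × C) (A × B × C) ℂ) (l : ℝ) : Prop :=
  Tendsto (fun n : ℕ => mergingFidelity (tensorPow₃ ρ n)) atTop (𝓝 l)

/-- A tripartite operator, read in the bipartition `AB : C`.
(In the bipartition `A : BC` no regrouping is needed.) -/
def cutABC (ρ : Matrix (A × B × C) (A × B × C) ℂ) : Matrix ((A × B) × C) ((A × B) × C) ℂ :=
  Matrix.of fun i j => ρ (i.1.1, i.1.2, i.2) (j.1.1, j.1.2, j.2)

/-! ## Measure on the set of states -/

/-- The affine space of Hermitian matrices of trace one, in which the set of states has nonempty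
interior. -/
def hermitianTraceOne (n : Type) [Fintype n] : Set (Matrix n n ℂ) :=
  {M | M.IsHermitian ∧ M.trace = 1}

/-- The real vector space of traceless Hermitian matrices. -/
def tracelessHermitian (n : Type) [Fintype n] : Submodule ℝ (Matrix n n ℂ) where
  carrier := {M | M.IsHermitian ∧ M.trace = 0}
  add_mem' := fun ha hb => ⟨ha.1.add hb.1, by rw [Matrix.trace_add, ha.2, hb.2, add_zero]⟩
  zero_mem' := ⟨Matrix.isHermitian_zero, Matrix.trace_zero n ℂ⟩
  smul_mem' := fun c x hx =>
    ⟨by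
      have h : xᴴ = x := hx.1
      simp [Matrix.IsHermitian, Matrix.conjTranspose_smul, h], by
      rw [Matrix.trace_smul, hx.2, smul_zero]⟩

instance (n : Type) [Fintype n] : MeasurableSpace (tracelessHermitian n) := borel _

instance (n : Type) [Fintype n] : BorelSpace (tracelessHermitian n) := ⟨rfl⟩

/-- The set `S` has nonzero Lebesgue measure in the affine space of Hermitian matrices of trace one.
The point `𝟙 / d` is the origin; Lebesgue measure on the traceless Hermitian matrices is
translation invariant and unique up to a positive factor. -/
def HasNonzeroMeasure {n : Type} [Fintype n] [DecidableEq n] (S : Set (Matrix n n ℂ)) : Prop :=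
  ∀ (ν : Measure (tracelessHermitian n)) [ν.IsAddHaarMeasure],
    ν {H | ((Fintype.card n : ℂ)⁻¹ • (1 : Matrix n n ℂ) + (H : Matrix n n ℂ)) ∈ S} ≠ 0

/-! ## The family of three-qubit states -/

/-- `(1 - p) |φ⁺⟩⟨φ⁺| ⊗ |0⟩⟨0| + p 𝟙 / 8`. -/
def witnessState (p : ℝ) : Matrix (Fin 2 × Fin 2 × Fin 2) (Fin 2 × Fin 2 × Fin 2) ℂ :=
  (1 - p : ℂ) • Matrix.of (fun i j => phiPlus (i.1, i.2.1) (j.1, j.2.1) *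
    (if i.2.2 = 0 ∧ j.2.2 = 0 then 1 else 0)) + (p / 8 : ℂ) • 1

end PQSM

end

/-! Why merging fails. Let ρ be PPT across AB:C. Adding a register state at Charlie and a PPT
ancilla keeps the joint state PPT between A with Bob and Charlie, and LOCC between Bob and Charlie
preserves this property, A being a spectator on Bob's side. So every final state is PPT across A:CR
(`mergedState_isDensity_isPPT`). The target is ρ itself, read in the cut A:BC. Suppose singlets can
be distilled across that cut at a rate r > 0. The test "distil n copies, then project onto the
maximally entangled state of dimension 2^⌊nr⌋" succeeds on the target with probability tending to 1,
but on a PPT state with probability at most 2^(-⌊nr⌋) (`re_overlap_le_of_isPPT`). The fidelity of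
two states is at most the classical fidelity of the statistics of any test (`fidelity_le`), so it
tends to zero (`hasAsymptoticFidelity_zero`).

Why this happens on an open set. Both properties used must survive small perturbations. For
separability, the witness state is an AB:C-product operator plus a positive multiple of the
identity, and Hermitian operators near the identity are separable (`near_one_mem_separableCone`).
For distillability, a state is distillable exactly when some LOCC map on finitely many copies
produces a qubit pair whose overlap with the maximally entangled state exceeds 99/100; for a fixed
map this overlap is continuous in the state (`eventually_distillable`).

The sufficiency of such an overlap needs an actual protocol. The pair is twirled to a Bell diagonal
state, that is, to a random bit flip and phase flip; 3m such pairs are then hashed by a random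
linear code. One block of m pairs reveals a syndrome of the bit flips, a second one a syndrome of
the phase flips, and the third is corrected and kept (`exists_isLOCC_hash_bellDiagonal`). The rate
1/3 per pair is far from optimal, but only its positivity matters. -/

namespace PQSM

/-! ## Local operations -/

section LocalOperations

variable {X Y X' Y' X'' Y'' : Type}
  [Fintype X] [DecidableEq X] [Fintype Y] [DecidableEq Y]
  [Fintype X'] [DecidableEq X'] [Fintype Y'] [DecidableEq Y']
  [Fintype X''] [DecidableEq X''] [Fintype Y''] [DecidableEq Y'']

omit [DecidableEq X] [DecidableEq Y] [Fintype X'] [DecidableEq X'] [Fintype Y'] [DecidableEq Y'] in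
theorem kronecker_conj_apply (K : Matrix X' X ℂ) (L : Matrix Y' Y ℂ)
    (τ : Matrix (X × Y) (X × Y) ℂ) (i j : X' × Y') :
    ((K ⊗ₖ L) * τ * (K ⊗ₖ L)ᴴ) i j =
      ∑ a, ∑ b, ∑ a', ∑ b', K i.1 a * L i.2 b * τ (a, b) (a', b') *
        (star (K j.1 a') * star (L j.2 b')) := by
  simp only [Matrix.mul_apply, Matrix.conjTranspose_apply, Matrix.kroneckerMap_apply,
    Finset.sum_mul, Fintype.sum_prod_type, star_mul']
  calc _ = ∑ a', ∑ a, ∑ b', ∑ b, K i.1 a * L i.2 b * τ (a, b) (a', b') *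
        (star (K j.1 a') * star (L j.2 b')) :=
        Finset.sum_congr rfl fun _ _ => Finset.sum_comm
    _ = ∑ a, ∑ a', ∑ b, ∑ b', K i.1 a * L i.2 b * τ (a, b) (a', b') *
        (star (K j.1 a') * star (L j.2 b')) := by
        rw [Finset.sum_comm]
        exact Finset.sum_congr rfl fun _ _ => Finset.sum_congr rfl fun _ _ => Finset.sum_comm
    _ = _ := Finset.sum_congr rfl fun _ _ => Finset.sum_comm

omit [DecidableEq X] [Fintype X'] [DecidableEq X'] in
theorem kronecker_one_conj_apply (K : Matrix X' X ℂ)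
    (τ : Matrix (X × Y) (X × Y) ℂ) (i j : X' × Y) :
    ((K ⊗ₖ (1 : Matrix Y Y ℂ)) * τ * (K ⊗ₖ (1 : Matrix Y Y ℂ))ᴴ) i j =
      ∑ a, ∑ a', K i.1 a * τ (a, i.2) (a', j.2) * star (K j.1 a') := by
  rw [kronecker_conj_apply]
  refine Finset.sum_congr rfl fun a _ => ?_
  rw [Finset.sum_comm]
  simp [Matrix.one_apply, apply_ite star]

omit [DecidableEq Y] [Fintype Y'] [DecidableEq Y'] in
theorem one_kronecker_conj_apply (L : Matrix Y' Y ℂ)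
    (τ : Matrix (X × Y) (X × Y) ℂ) (i j : X × Y') :
    (((1 : Matrix X X ℂ) ⊗ₖ L) * τ * ((1 : Matrix X X ℂ) ⊗ₖ L)ᴴ) i j =
      ∑ b, ∑ b', L i.2 b * τ (i.1, b) (j.1, b') * star (L j.2 b') := by
  rw [kronecker_conj_apply]
  simp [Matrix.one_apply, apply_ite star]

-- Transposing the second factor turns L into its complex conjugate. The result is again a
-- congruence, which is why local Kraus operators cannot destroy positivity of the partial
-- transpose.
omit [DecidableEq X] [DecidableEq Y] [Fintype X'] [DecidableEq X'] [Fintype Y'] [DecidableEq Y'] in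
theorem partialTranspose_kronecker_conj (K : Matrix X' X ℂ) (L : Matrix Y' Y ℂ)
    (τ : Matrix (X × Y) (X × Y) ℂ) :
    partialTranspose ((K ⊗ₖ L) * τ * (K ⊗ₖ L)ᴴ) =
      (K ⊗ₖ L.map star) * partialTranspose τ * (K ⊗ₖ L.map star)ᴴ := by
  ext i j
  simp only [partialTranspose, Matrix.of_apply, kronecker_conj_apply, Matrix.map_apply, star_star]
  refine Finset.sum_congr rfl fun a _ => ?_
  rw [Finset.sum_comm]
  conv_rhs => rw [Finset.sum_comm]
  refine Finset.sum_congr rfl fun a' _ => ?_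
  rw [Finset.sum_comm]
  refine Finset.sum_congr rfl fun b _ => Finset.sum_congr rfl fun b' _ => by ring

theorem trace_sum_conj {ι U : Type} [Fintype ι] [Fintype U] [DecidableEq U] {V : ι → Type}
    [∀ k, Fintype (V k)] (K : ∀ k, Matrix (V k) U ℂ) (hK : ∑ k, (K k)ᴴ * K k = 1) (τ : Matrix U U ℂ) :
    ∑ k, (K k * τ * (K k)ᴴ).trace = τ.trace := by
  calc _ = ∑ k, ((K k)ᴴ * K k * τ).trace :=
        Finset.sum_congr rfl fun k _ => by rw [Matrix.trace_mul_comm, Matrix.mul_assoc]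
    _ = _ := by rw [← Matrix.trace_sum, ← Finset.sum_mul, hK, Matrix.one_mul]

namespace IsLOCC

theorem congr {Λ Λ' : Matrix (X × Y) (X × Y) ℂ → Matrix (X' × Y') (X' × Y') ℂ}
    (h : IsLOCC Λ) (e : ∀ τ, Λ τ = Λ' τ) : IsLOCC Λ' :=
  funext e ▸ h

theorem isLinearMap {Λ : Matrix (X × Y) (X × Y) ℂ → Matrix (X' × Y') (X' × Y') ℂ}
    (h : IsLOCC Λ) : IsLinearMap ℂ Λ := by
  induction h with
  | nil => exact ⟨fun _ _ => rfl, fun _ _ => rfl⟩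
  | left K hK Λ hΛ ih =>
    refine ⟨fun a b => ?_, fun c a => ?_⟩
    · simp_rw [Matrix.mul_add, Matrix.add_mul, (ih _).map_add, Finset.sum_add_distrib]
    · simp_rw [Matrix.mul_smul, Matrix.smul_mul, (ih _).map_smul, Finset.smul_sum]
  | right K hK Λ hΛ ih =>
    refine ⟨fun a b => ?_, fun c a => ?_⟩
    · simp_rw [Matrix.mul_add, Matrix.add_mul, (ih _).map_add, Finset.sum_add_distrib]
    · simp_rw [Matrix.mul_smul, Matrix.smul_mul, (ih _).map_smul, Finset.smul_sum]

theorem map_sum {Λ : Matrix (X × Y) (X × Y) ℂ → Matrix (X' × Y') (X' × Y') ℂ}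
    (h : IsLOCC Λ) {ι : Type*} (s : Finset ι) (f : ι → Matrix (X × Y) (X × Y) ℂ) :
    Λ (∑ i ∈ s, f i) = ∑ i ∈ s, Λ (f i) :=
  _root_.map_sum h.isLinearMap.mk' f s

theorem trace_eq {Λ : Matrix (X × Y) (X × Y) ℂ → Matrix (X' × Y') (X' × Y') ℂ}
    (h : IsLOCC Λ) (τ : Matrix (X × Y) (X × Y) ℂ) : (Λ τ).trace = τ.trace := by
  induction h with
  | nil => rfl
  | @left X Y _ _ _ _ m Z _ _ K hK Λ hΛ ih =>
    simp_rw [Matrix.trace_sum, ih, Matrix.trace, Matrix.diag, Fintype.sum_prod_type,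
      kronecker_one_conj_apply]
    have := fun y => trace_sum_conj K hK (Matrix.of fun x x' => τ (x, y) (x', y))
    simp only [Matrix.trace, Matrix.diag, Matrix.mul_apply, Matrix.conjTranspose_apply,
      Matrix.of_apply, Finset.sum_mul] at this
    calc _ = ∑ y, ∑ k, ∑ z, ∑ a', ∑ a, K k z a * τ (a, y) (a', y) * star (K k z a') := by
          conv_rhs => rw [Finset.sum_comm]
          refine Finset.sum_congr rfl fun k _ => ?_
          rw [Finset.sum_comm]
          exact Finset.sum_congr rfl fun y _ => Finset.sum_congr rfl fun z _ => Finset.sum_comm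
      _ = _ := by
          rw [Finset.sum_congr rfl fun y _ => this y, Finset.sum_comm]
  | @right X Y _ _ _ _ m Z _ _ K hK Λ hΛ ih =>
    simp_rw [Matrix.trace_sum, ih, Matrix.trace, Matrix.diag, Fintype.sum_prod_type,
      one_kronecker_conj_apply]
    have := fun x => trace_sum_conj K hK (Matrix.of fun y y' => τ (x, y) (x, y'))
    simp only [Matrix.trace, Matrix.diag, Matrix.mul_apply, Matrix.conjTranspose_apply,
      Matrix.of_apply, Finset.sum_mul] at this
    calc _ = ∑ x, ∑ k, ∑ z, ∑ a', ∑ a, K k z a * τ (x, a) (x, a') * star (K k z a') := by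
          conv_rhs => rw [Finset.sum_comm]
          exact Finset.sum_congr rfl fun k _ => Finset.sum_congr rfl fun y _ =>
            Finset.sum_congr rfl fun z _ => Finset.sum_comm
      _ = _ := Finset.sum_congr rfl fun y _ => this y

theorem posSemidef {Λ : Matrix (X × Y) (X × Y) ℂ → Matrix (X' × Y') (X' × Y') ℂ}
    (h : IsLOCC Λ) {τ : Matrix (X × Y) (X × Y) ℂ} (hτ : τ.PosSemidef) : (Λ τ).PosSemidef := by
  induction h with
  | nil => exact hτ
  | left K hK Λ hΛ ih =>
    exact Matrix.posSemidef_sum _ fun k _ => ih k (hτ.mul_mul_conjTranspose_same _)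
  | right K hK Λ hΛ ih =>
    exact Matrix.posSemidef_sum _ fun k _ => ih k (hτ.mul_mul_conjTranspose_same _)

theorem isDensity {Λ : Matrix (X × Y) (X × Y) ℂ → Matrix (X' × Y') (X' × Y') ℂ}
    (h : IsLOCC Λ) {τ : Matrix (X × Y) (X × Y) ℂ} (hτ : IsDensity τ) : IsDensity (Λ τ) :=
  ⟨h.posSemidef hτ.posSemidef, by rw [h.trace_eq, hτ.trace_eq_one]⟩

/-- Every branch of the protocol is a local congruence, also after partial transposition, and the
outcomes are summed. -/
theorem isPPT {Λ : Matrix (X × Y) (X × Y) ℂ → Matrix (X' × Y') (X' × Y') ℂ}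
    (h : IsLOCC Λ) {τ : Matrix (X × Y) (X × Y) ℂ} (hτ : IsPPT τ) : IsPPT (Λ τ) := by
  have sum_ppt : ∀ {m : ℕ} (f : Fin m → Matrix (X' × Y') (X' × Y') ℂ),
      (∀ k, IsPPT (f k)) → IsPPT (∑ k, f k) := by
    intro m f hf
    have : partialTranspose (∑ k, f k) = ∑ k, partialTranspose (f k) := by
      ext i j
      simp [partialTranspose, Matrix.sum_apply]
    rw [IsPPT, this]
    exact Matrix.posSemidef_sum _ fun k _ => hf k
  induction h with
  | nil => exact hτ
  | left K hK Λ hΛ ih =>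
    refine sum_ppt _ fun k => ih k ?_
    rw [IsPPT, partialTranspose_kronecker_conj]
    exact Matrix.PosSemidef.mul_mul_conjTranspose_same hτ _
  | right K hK Λ hΛ ih =>
    refine sum_ppt _ fun k => ih k ?_
    rw [IsPPT, partialTranspose_kronecker_conj]
    exact Matrix.PosSemidef.mul_mul_conjTranspose_same hτ _

theorem comp {Λ₂ : Matrix (X' × Y') (X' × Y') ℂ → Matrix (X'' × Y'') (X'' × Y'') ℂ}
    (h₂ : IsLOCC Λ₂) {Λ₁ : Matrix (X × Y) (X × Y) ℂ → Matrix (X' × Y') (X' × Y') ℂ}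
    (h₁ : IsLOCC Λ₁) : IsLOCC fun τ => Λ₂ (Λ₁ τ) := by
  induction h₁ with
  | nil => exact h₂
  | left K hK Λ hΛ ih =>
    exact (IsLOCC.left K hK _ ih).congr fun τ => (h₂.map_sum _ _).symm
  | right K hK Λ hΛ ih =>
    exact (IsLOCC.right K hK _ ih).congr fun τ => (h₂.map_sum _ _).symm

theorem left_of_fintype {ι Z : Type} [Fintype ι] [Fintype Z] [DecidableEq Z]
    (K : ι → Matrix Z X ℂ) (hK : ∑ k, (K k)ᴴ * K k = 1)
    {Λ : ι → Matrix (Z × Y) (Z × Y) ℂ → Matrix (X' × Y') (X' × Y') ℂ}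
    (hΛ : ∀ k, IsLOCC (Λ k)) :
    IsLOCC (fun τ : Matrix (X × Y) (X × Y) ℂ =>
      ∑ k, Λ k ((K k ⊗ₖ (1 : Matrix Y Y ℂ)) * τ * (K k ⊗ₖ (1 : Matrix Y Y ℂ))ᴴ)) := by
  let e := (Fintype.equivFin ι).symm
  refine (IsLOCC.left (fun k => K (e k)) ((e.sum_comp fun k => (K k)ᴴ * K k).trans hK) _
    fun k => hΛ (e k)).congr fun τ => ?_
  exact e.sum_comp fun k => Λ k ((K k ⊗ₖ (1 : Matrix Y Y ℂ)) * τ * (K k ⊗ₖ (1 : Matrix Y Y ℂ))ᴴ)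

theorem right_of_fintype {ι Z : Type} [Fintype ι] [Fintype Z] [DecidableEq Z]
    (K : ι → Matrix Z Y ℂ) (hK : ∑ k, (K k)ᴴ * K k = 1)
    {Λ : ι → Matrix (X × Z) (X × Z) ℂ → Matrix (X' × Y') (X' × Y') ℂ}
    (hΛ : ∀ k, IsLOCC (Λ k)) :
    IsLOCC (fun τ : Matrix (X × Y) (X × Y) ℂ =>
      ∑ k, Λ k (((1 : Matrix X X ℂ) ⊗ₖ K k) * τ * ((1 : Matrix X X ℂ) ⊗ₖ K k)ᴴ)) := by
  let e := (Fintype.equivFin ι).symm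
  refine (IsLOCC.right (fun k => K (e k)) ((e.sum_comp fun k => (K k)ᴴ * K k).trans hK) _
    fun k => hΛ (e k)).congr fun τ => ?_
  exact e.sum_comp fun k => Λ k (((1 : Matrix X X ℂ) ⊗ₖ K k) * τ * ((1 : Matrix X X ℂ) ⊗ₖ K k)ᴴ)

/-- One-way LOCC: the first party measures, the second party applies a channel that depends on the
outcome. -/
theorem oneWay {ι κ : Type} [Fintype ι] [Fintype κ]
    (K : ι → Matrix X' X ℂ) (hK : ∑ k, (K k)ᴴ * K k = 1)
    (L : ι → κ → Matrix Y' Y ℂ) (hL : ∀ k, ∑ l, (L k l)ᴴ * L k l = 1) :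
    IsLOCC (fun τ : Matrix (X × Y) (X × Y) ℂ =>
      ∑ k, ∑ l, (K k ⊗ₖ L k l) * τ * (K k ⊗ₖ L k l)ᴴ) := by
  refine (left_of_fintype K hK fun k => right_of_fintype (L k) (hL k) fun l => nil).congr
    fun τ => ?_
  refine Finset.sum_congr rfl fun k _ => Finset.sum_congr rfl fun l _ => ?_
  have : K k ⊗ₖ L k l = ((1 : Matrix X' X' ℂ) ⊗ₖ L k l) * (K k ⊗ₖ (1 : Matrix Y Y ℂ)) := by
    rw [← Matrix.mul_kronecker_mul, Matrix.one_mul, Matrix.mul_one]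
  rw [this, Matrix.conjTranspose_mul]
  simp only [Matrix.mul_assoc]

/-- Both parties discard a part of their systems. -/
theorem discard {S T : Type} [Fintype S] [DecidableEq S] [Fintype T] [DecidableEq T]
    (e : X ≃ X' × S) (f : Y ≃ Y' × T) :
    IsLOCC (fun τ : Matrix (X × Y) (X × Y) ℂ => Matrix.of fun i j : X' × Y' =>
      ∑ s, ∑ t, τ (e.symm (i.1, s), f.symm (i.2, t)) (e.symm (j.1, s), f.symm (j.2, t))) := by
  -- A partial trace is a measurement of the discarded factor in its basis with the outcome ignored;
  -- the Kraus operators are 1 ⊗ ⟨w|.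
  have key : ∀ {U V W : Type} [Fintype U] [DecidableEq U] [Fintype V] [DecidableEq V] [Fintype W]
      [DecidableEq W] (g : U ≃ V × W),
      ∑ w, (Matrix.of fun v u => if u = g.symm (v, w) then (1 : ℂ) else 0)ᴴ *
        (Matrix.of fun v u => if u = g.symm (v, w) then (1 : ℂ) else 0) = (1 : Matrix U U ℂ) := by
    intro U V W _ _ _ _ _ _ g
    ext a b
    simp only [Matrix.sum_apply, Matrix.mul_apply, Matrix.conjTranspose_apply, Matrix.of_apply,
      apply_ite star, star_one, star_zero]
    rw [Finset.sum_comm, ← Fintype.sum_prod_type' (f := fun v w =>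
      (if a = g.symm (v, w) then (1 : ℂ) else 0) * if b = g.symm (v, w) then 1 else 0),
      g.symm.sum_comp fun u => (if a = u then (1 : ℂ) else 0) * if b = u then 1 else 0]
    simp [Matrix.one_apply]
  refine (oneWay (fun s => Matrix.of fun v u => if u = e.symm (v, s) then (1 : ℂ) else 0) (key e)
    (fun _ t => Matrix.of fun v u => if u = f.symm (v, t) then (1 : ℂ) else 0)
    (fun _ => key f)).congr fun τ => ?_
  ext i j
  simp only [Matrix.sum_apply, kronecker_conj_apply]
  simp [apply_ite star]

/-- Both parties relabel the basis states of their systems. -/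
theorem relabel (e : X' ≃ X) (f : Y' ≃ Y) :
    IsLOCC (fun τ : Matrix (X × Y) (X × Y) ℂ => τ.submatrix (Prod.map e f) (Prod.map e f)) := by
  refine (discard (S := Unit) (T := Unit) (e.symm.trans (Equiv.prodUnique _ _).symm)
    (f.symm.trans (Equiv.prodUnique _ _).symm)).congr fun τ => ?_
  ext i j
  simp [Prod.map]

end IsLOCC

/-- `Λ ⊗ id`, with spectators `S` on the side of the first and `T` on the side of the second
party. -/
noncomputable def tensorId (S T : Type)
    (Λ : Matrix (X × Y) (X × Y) ℂ → Matrix (X' × Y') (X' × Y') ℂ)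
    (ω : Matrix ((X × S) × (Y × T)) ((X × S) × (Y × T)) ℂ) :
    Matrix ((X' × S) × (Y' × T)) ((X' × S) × (Y' × T)) ℂ :=
  Matrix.of fun i j => Λ (Matrix.of fun p q =>
    ω ((p.1, i.1.2), (p.2, i.2.2)) ((q.1, j.1.2), (q.2, j.2.2))) (i.1.1, i.2.1) (j.1.1, j.2.1)

theorem sum_kronecker_one {ι S U : Type} [Fintype ι] [Fintype S] [DecidableEq S] [Fintype U]
    [DecidableEq U] {Z : ι → Type} [∀ k, Fintype (Z k)] [∀ k, DecidableEq (Z k)]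
    (K : ∀ k, Matrix (Z k) U ℂ) (hK : ∑ k, (K k)ᴴ * K k = 1) :
    ∑ k, (K k ⊗ₖ (1 : Matrix S S ℂ))ᴴ * (K k ⊗ₖ (1 : Matrix S S ℂ)) = 1 := by
  simp_rw [Matrix.conjTranspose_kronecker, ← Matrix.mul_kronecker_mul, Matrix.conjTranspose_one,
    Matrix.one_mul]
  ext i j
  have := congr_fun₂ hK i.1 j.1
  simp only [Matrix.sum_apply, Matrix.kroneckerMap_apply, ← Finset.sum_mul] at this ⊢
  rw [this, ← Matrix.one_kronecker_one]
  rfl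

/-- The same protocol with each Kraus operator K replaced by K ⊗ 1. This serves both for the
spectator A in merging and for running protocols on several copies. -/
theorem IsLOCC.tensorId {S T : Type} [Fintype S] [DecidableEq S] [Fintype T] [DecidableEq T]
    {Λ : Matrix (X × Y) (X × Y) ℂ → Matrix (X' × Y') (X' × Y') ℂ} (h : IsLOCC Λ) :
    IsLOCC (PQSM.tensorId S T Λ) := by
  induction h with
  | nil => exact nil
  | left K hK Λ hΛ ih =>
    refine (left (fun k => K k ⊗ₖ (1 : Matrix S S ℂ)) (sum_kronecker_one K hK) _ ih).congr
      fun ω => ?_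
    ext i j
    simp only [Matrix.sum_apply, PQSM.tensorId, Matrix.of_apply]
    refine Finset.sum_congr rfl fun k _ => ?_
    refine congr_fun₂ (congrArg (Λ k) ?_) _ _
    ext p q
    simp only [Matrix.of_apply, kronecker_one_conj_apply, Fintype.sum_prod_type,
      Matrix.kroneckerMap_apply, Matrix.one_apply]
    simp [apply_ite star]
  | right K hK Λ hΛ ih =>
    refine (right (fun k => K k ⊗ₖ (1 : Matrix T T ℂ)) (sum_kronecker_one K hK) _ ih).congr
      fun ω => ?_
    ext i j
    simp only [Matrix.sum_apply, PQSM.tensorId, Matrix.of_apply]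
    refine Finset.sum_congr rfl fun k _ => ?_
    refine congr_fun₂ (congrArg (Λ k) ?_) _ _
    ext p q
    simp only [Matrix.of_apply, one_kronecker_conj_apply, Fintype.sum_prod_type,
      Matrix.kroneckerMap_apply, Matrix.one_apply]
    simp [apply_ite star]

end LocalOperations

/-! ## Trace norm and fidelity -/

section MatrixAnalysis

variable {n : Type} [Fintype n]

theorem trace_mul_nonneg {P Q : Matrix n n ℂ} (hP : P.PosSemidef) (hQ : Q.PosSemidef) :
    0 ≤ (P * Q).trace := by
  classical
  open scoped MatrixOrder in
  obtain ⟨B, rfl⟩ := CStarAlgebra.nonneg_iff_eq_star_mul_self.mp hP.nonneg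
  rw [Matrix.mul_assoc, Matrix.trace_mul_comm]
  exact (hQ.mul_mul_conjTranspose_same B).trace_nonneg

variable [DecidableEq n]

/-- The spectrum is finite, so discontinuous functions such as the sign or a pseudo-inverse are
allowed in the functional calculus. -/
theorem continuousOn_real_spectrum (M : Matrix n n ℂ) (f : ℝ → ℝ) :
    ContinuousOn f (spectrum ℝ M) :=
  M.finite_real_spectrum.continuousOn f

theorem spectrum_nonneg {M : Matrix n n ℂ} (hM : M.PosSemidef) {x : ℝ} (hx : x ∈ spectrum ℝ M) :
    0 ≤ x := by
  rw [hM.1.spectrum_real_eq_range_eigenvalues] at hx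
  obtain ⟨i, rfl⟩ := hx
  exact hM.eigenvalues_nonneg i

theorem cfc_posSemidef {f : ℝ → ℝ} {M : Matrix n n ℂ} (h : ∀ x ∈ spectrum ℝ M, 0 ≤ f x) :
    (cfc f M).PosSemidef := by
  open scoped MatrixOrder in
  exact Matrix.nonneg_iff_posSemidef.mp (cfc_nonneg h)

theorem msqrt_posSemidef (M : Matrix n n ℂ) : (msqrt M).PosSemidef :=
  cfc_posSemidef fun _ _ => Real.sqrt_nonneg _

theorem msqrt_mul_msqrt {M : Matrix n n ℂ} (hM : M.PosSemidef) : msqrt M * msqrt M = M := by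
  have hs : IsSelfAdjoint M := hM.1
  rw [msqrt, ← cfc_mul _ _ M (continuousOn_real_spectrum _ _) (continuousOn_real_spectrum _ _)]
  conv_rhs => rw [← cfc_id' ℝ M]
  exact cfc_congr fun x hx => Real.mul_self_sqrt (spectrum_nonneg hM hx)

theorem msqrt_conjTranspose_mul_self {M : Matrix n n ℂ} (hM : M.IsHermitian) :
    msqrt (Mᴴ * M) = cfc (fun x : ℝ => |x|) M := by
  have hs : IsSelfAdjoint M := hM
  have h2 : Mᴴ * M = cfc (fun x : ℝ => x * x) M := by
    rw [cfc_mul _ _ M (continuousOn_real_spectrum _ _) (continuousOn_real_spectrum _ _),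
      cfc_id' ℝ M, hM.eq]
  rw [h2, msqrt, ← cfc_comp' Real.sqrt (fun x : ℝ => x * x) M
    (Real.continuous_sqrt.continuousOn) (continuousOn_real_spectrum _ _)]
  exact cfc_congr fun x _ => Real.sqrt_mul_self_eq_abs x

theorem traceNorm_of_posSemidef {M : Matrix n n ℂ} (hM : M.PosSemidef) :
    traceNorm M = M.trace.re := by
  have hs : IsSelfAdjoint M := hM.1
  rw [traceNorm, msqrt_conjTranspose_mul_self hM.1]
  congr 2
  conv_rhs => rw [← cfc_id' ℝ M]
  exact cfc_congr fun x hx => abs_of_nonneg (spectrum_nonneg hM hx)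

/-- With S the sign of H = P - Q, the trace norm is Tr(PS) - Tr(QS), and -1 ≤ S ≤ 1. -/
theorem traceNorm_sub_le {P Q : Matrix n n ℂ} (hP : P.PosSemidef) (hQ : Q.PosSemidef) :
    traceNorm (P - Q) ≤ P.trace.re + Q.trace.re := by
  set H := P - Q with hH
  have hH' : H.IsHermitian := hP.1.sub hQ.1
  have hs : IsSelfAdjoint H := hH'
  set S : Matrix n n ℂ := cfc (fun x : ℝ => (SignType.sign x : ℝ)) H with hS
  have hcont := continuousOn_real_spectrum H
  have h1 : (1 - S).PosSemidef := by
    rw [hS, ← cfc_one ℝ H, ← cfc_sub _ _ H (hcont _) (hcont _)]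
    refine cfc_posSemidef fun x _ => ?_
    rcases lt_trichotomy x 0 with h | h | h <;> simp [h]
  have h2 : (1 + S).PosSemidef := by
    rw [hS, ← cfc_one ℝ H, ← cfc_add H _ _ (hcont _) (hcont _)]
    refine cfc_posSemidef fun x _ => ?_
    rcases lt_trichotomy x 0 with h | h | h <;> simp [h]
  have h3 : cfc (fun x : ℝ => |x|) H = H * S := by
    conv_rhs => enter [1]; rw [← cfc_id' ℝ H]
    rw [hS, ← cfc_mul _ _ H (hcont _) (hcont _)]
    exact cfc_congr fun x _ => (self_mul_sign x).symm
  rw [traceNorm, msqrt_conjTranspose_mul_self hH', h3, hH, sub_mul, Matrix.trace_sub,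
    Complex.sub_re]
  have h4 := (Complex.le_def.mp (trace_mul_nonneg hP h1)).1
  have h5 := (Complex.le_def.mp (trace_mul_nonneg hQ h2)).1
  simp only [Matrix.mul_sub, Matrix.mul_add, Matrix.mul_one, Matrix.trace_sub, Matrix.trace_add,
    Complex.sub_re, Complex.add_re, Complex.zero_re] at h4 h5
  linarith

/-- Tr(HE) ≤ Tr(|H|E) ≤ Tr|H|, because H ≤ |H| and 0 ≤ E ≤ 1. -/
theorem re_trace_mul_le_traceNorm {H E : Matrix n n ℂ} (hH : H.IsHermitian) (hE : E.PosSemidef)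
    (hE' : (1 - E).PosSemidef) : (H * E).trace.re ≤ traceNorm H := by
  have hs : IsSelfAdjoint H := hH
  rw [traceNorm, msqrt_conjTranspose_mul_self hH]
  set B : Matrix n n ℂ := cfc (fun x : ℝ => |x|) H with hB
  have hcont := continuousOn_real_spectrum H
  have h1 : (B - H).PosSemidef := by
    conv => enter [1, 2]; rw [← cfc_id' ℝ H]
    rw [hB, ← cfc_sub _ _ H (hcont _) (hcont _)]
    exact cfc_posSemidef fun x _ => sub_nonneg.mpr (le_abs_self x)
  have h2 : B.PosSemidef := cfc_posSemidef fun x _ => abs_nonneg x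
  have h4 := (Complex.le_def.mp (trace_mul_nonneg h1 hE)).1
  have h5 := (Complex.le_def.mp (trace_mul_nonneg h2 hE')).1
  simp only [Matrix.mul_sub, Matrix.sub_mul, Matrix.mul_one, Matrix.trace_sub,
    Complex.sub_re, Complex.zero_re] at h4 h5
  linarith

-- Cauchy–Schwarz for the positive semidefinite form (X, Y) ↦ f(X†Y), obtained from the discriminant
-- of t ↦ f((X + tY)†(X + tY)).
omit [DecidableEq n] in
theorem re_apply_conjTranspose_mul_le (f : Matrix n n ℂ →ₗ[ℂ] ℂ)
    (hf : ∀ τ : Matrix n n ℂ, τ.PosSemidef → 0 ≤ f τ) (X Y : Matrix n n ℂ) :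
    (f (Xᴴ * Y)).re ≤ √(f (Xᴴ * X)).re * √(f (Yᴴ * Y)).re := by
  have h0 : ∀ Z : Matrix n n ℂ, 0 ≤ (f (Zᴴ * Z)).re ∧ (f (Zᴴ * Z)).im = 0 := fun Z => by
    have := Complex.le_def.mp (hf _ (Matrix.posSemidef_conjTranspose_mul_self Z))
    exact ⟨this.1, this.2.symm⟩
  have expand : ∀ c : ℂ, f ((X + c • Y)ᴴ * (X + c • Y)) = f (Xᴴ * X) + c * f (Xᴴ * Y) +
      star c * f (Yᴴ * X) + star c * c * f (Yᴴ * Y) := fun c => by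
    simp only [Matrix.conjTranspose_add, Matrix.conjTranspose_smul, Matrix.add_mul, Matrix.mul_add,
      Matrix.smul_mul, Matrix.mul_smul, map_add, map_smul, smul_eq_mul]
    ring
  -- The form is real on the diagonal; the imaginary part at X + iY is the difference of the two
  -- sides.
  have hsymm : (f (Yᴴ * X)).re = (f (Xᴴ * Y)).re := by
    have := (h0 (X + Complex.I • Y)).2
    rw [expand] at this
    simp [(h0 X).2, (h0 Y).2] at this
    linarith
  have hquad : ∀ t : ℝ, 0 ≤ (f (Yᴴ * Y)).re * (t * t) + 2 * (f (Xᴴ * Y)).re * t +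
      (f (Xᴴ * X)).re := fun t => by
    have := (h0 (X + (t : ℂ) • Y)).1
    rw [expand] at this
    simp [hsymm] at this
    linarith
  have hd := discrim_le_zero hquad
  rw [discrim] at hd
  rw [← Real.sqrt_mul (h0 X).1]
  refine (le_abs_self _).trans (Real.abs_le_sqrt ?_)
  linarith

/-- The fidelity is at most the classical fidelity of the statistics of a two-outcome measurement,
given by a positive functional `f` below the trace. -/
theorem fidelity_le {ρ σ : Matrix n n ℂ} (hρ : ρ.PosSemidef) (hσ : σ.PosSemidef)
    (f : Matrix n n ℂ →ₗ[ℂ] ℂ) (hf : ∀ τ : Matrix n n ℂ, τ.PosSemidef → 0 ≤ f τ)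
    (hf' : ∀ τ : Matrix n n ℂ, τ.PosSemidef → f τ ≤ τ.trace) :
    fidelity ρ σ ≤ √(f ρ).re * √(f σ).re +
      √(ρ.trace.re - (f ρ).re) * √(σ.trace.re - (f σ).re) := by
  set R := msqrt ρ with hR
  set S := msqrt σ with hS
  have hRh : Rᴴ = R := (msqrt_posSemidef ρ).1
  have hSh : Sᴴ = S := (msqrt_posSemidef σ).1
  have hRR : R * R = ρ := msqrt_mul_msqrt hρ
  have hSS : S * S = σ := msqrt_mul_msqrt hσ
  set h := R * σ * R with hh
  have hpos : h.PosSemidef := by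
    have := hσ.conjTranspose_mul_mul_same R
    rwa [hRh] at this
  have hsa : IsSelfAdjoint h := hpos.1
  have hcont := continuousOn_real_spectrum h
  -- Since 0⁻¹ = 0, this is the pseudo-inverse of √h, and c h c is the support projection of h.
  set c : Matrix n n ℂ := cfc (fun x : ℝ => (√x)⁻¹) h with hc
  have hch : cᴴ = c := (cfc_posSemidef (M := h) fun x _ => inv_nonneg.mpr (Real.sqrt_nonneg x)).1
  have hcc : c * h = msqrt h := by
    rw [hc]
    conv_lhs => enter [2]; rw [← cfc_id' ℝ h]
    rw [← cfc_mul _ _ h (hcont _) (hcont _), msqrt]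
    exact cfc_congr fun x hx => by
      show (√x)⁻¹ * x = √x
      rw [inv_mul_eq_div, Real.div_sqrt]
  have hP : (1 - c * h * c).PosSemidef := by
    rw [hcc, msqrt, hc, ← cfc_mul _ _ h (hcont _) (hcont _), ← cfc_one ℝ h,
      ← cfc_sub _ _ h (hcont _) (hcont _)]
    refine cfc_posSemidef fun x _ => ?_
    show 0 ≤ 1 - √x * (√x)⁻¹
    have := mul_inv_le_one (a := √x)
    linarith
  -- S R c is the partial isometry U of the polar decomposition S R = U √h, and X = U R. Hence X†X ≤
  -- ρ, while Tr(X†S) = Tr √h is the fidelity.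
  set X := S * R * c * R with hX
  have hXX : ((f (Xᴴ * X)).re ≤ (f ρ).re) ∧
      (Xᴴ * X).trace.re - (f (Xᴴ * X)).re ≤ ρ.trace.re - (f ρ).re := by
    have hd : (ρ - Xᴴ * X).PosSemidef := by
      have := hP.conjTranspose_mul_mul_same R
      rw [hRh, Matrix.mul_sub, Matrix.mul_one, Matrix.sub_mul, hRR] at this
      convert this using 2
      simp only [hX, hh, Matrix.conjTranspose_mul, hRh, hSh, hch, ← hSS, Matrix.mul_assoc]
    have h1 := (Complex.le_def.mp (hf _ hd)).1
    have h2 := (Complex.le_def.mp (hf' _ hd)).1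
    simp only [map_sub, Matrix.trace_sub, Complex.sub_re, Complex.zero_re] at h1 h2
    constructor <;> linarith
  have htr : fidelity ρ σ = (Xᴴ * S).trace.re := by
    rw [fidelity, ← hR, ← hh, ← hcc, hX, hh]
    simp only [Matrix.conjTranspose_mul, hRh, hSh, hch, ← hSS, Matrix.mul_assoc]
    conv_rhs => rw [Matrix.trace_mul_comm]
    simp only [Matrix.mul_assoc]
  -- The complementary outcome of the test. Cauchy–Schwarz for f and for g, added up, bounds
  -- Tr(X†S).
  let g : Matrix n n ℂ →ₗ[ℂ] ℂ := Matrix.traceLinearMap n ℂ ℂ - f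
  have hg : ∀ τ, g τ = τ.trace - f τ := fun τ => rfl
  have e1 := re_apply_conjTranspose_mul_le f hf X S
  have e2 := re_apply_conjTranspose_mul_le g
    (fun τ hτ => by rw [hg]; exact sub_nonneg.mpr (hf' τ hτ)) X S
  simp only [hg, Complex.sub_re, hSh, hSS] at e1 e2
  rw [htr]
  have e3 : √(f (Xᴴ * X)).re * √(f σ).re ≤ √(f ρ).re * √(f σ).re :=
    mul_le_mul_of_nonneg_right (Real.sqrt_le_sqrt hXX.1) (Real.sqrt_nonneg _)
  have e4 := mul_le_mul_of_nonneg_right (Real.sqrt_le_sqrt hXX.2)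
    (Real.sqrt_nonneg (σ.trace.re - (f σ).re))
  linarith

theorem fidelity_nonneg (ρ σ : Matrix n n ℂ) : 0 ≤ fidelity ρ σ :=
  (Complex.le_def.mp (msqrt_posSemidef _).trace_nonneg).1

end MatrixAnalysis

/-! ## Separable states -/

section Separable

variable {X Y : Type}

theorem partialTranspose_kronecker (α : Matrix X X ℂ) (β : Matrix Y Y ℂ) :
    partialTranspose (α ⊗ₖ β) = α ⊗ₖ βᵀ :=
  rfl

theorem posSemidef_real_smul {n : Type} [Fintype n] {M : Matrix n n ℂ} (hM : M.PosSemidef) {c : ℝ}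
    (hc : 0 ≤ c) : (c • M).PosSemidef := by
  have := hM.smul (a := (c : ℂ)) (by exact_mod_cast hc)
  rwa [Complex.coe_smul] at this

theorem convex_posSemidef (n : Type) [Fintype n] : Convex ℝ {M : Matrix n n ℂ | M.PosSemidef} :=
  fun _ hx _ hy _ _ ha hb _ => (posSemidef_real_smul hx ha).add (posSemidef_real_smul hy hb)

variable [Fintype X] [Fintype Y]

theorem convex_isDensity_isPPT :
    Convex ℝ {τ : Matrix (X × Y) (X × Y) ℂ | IsDensity τ ∧ IsPPT τ} := by
  rintro x ⟨hx, hx'⟩ y ⟨hy, hy'⟩ a b ha hb hab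
  refine ⟨⟨convex_posSemidef _ hx.1 hy.1 ha hb hab, ?_⟩, convex_posSemidef _ hx' hy' ha hb hab⟩
  rw [Matrix.trace_add, Matrix.trace_smul, Matrix.trace_smul, hx.2, hy.2, ← add_smul, hab, one_smul]

theorem isDensity_isPPT_of_separable {τ : Matrix (X × Y) (X × Y) ℂ}
    (h : τ ∈ separableStates X Y) : IsDensity τ ∧ IsPPT τ := by
  refine convexHull_min ?_ convex_isDensity_isPPT h
  rintro _ ⟨α, β, hα, hβ, rfl⟩
  refine ⟨⟨hα.1.kronecker hβ.1, ?_⟩, ?_⟩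
  · rw [Matrix.trace_kronecker, hα.2, hβ.2, one_mul]
  · rw [IsPPT, partialTranspose_kronecker]
    exact hα.1.kronecker hβ.1.transpose

theorem logNegativity_eq_zero [DecidableEq X] [DecidableEq Y] {τ : Matrix (X × Y) (X × Y) ℂ}
    (h : τ.trace = 1) (h' : IsPPT τ) : logNegativity τ = 0 := by
  have : (partialTranspose τ).trace = 1 := h
  rw [logNegativity, traceNorm_of_posSemidef h', this, Complex.one_re, Real.logb_one]

/-- The nonnegative multiples of the separable states. -/
def separableCone (X Y : Type) [Fintype X] [Fintype Y] : Set (Matrix (X × Y) (X × Y) ℂ) :=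
  {τ | ∃ c : ℝ, 0 ≤ c ∧ ∃ s ∈ separableStates X Y, τ = c • s}

theorem separableCone_add {σ τ : Matrix (X × Y) (X × Y) ℂ} (hσ : σ ∈ separableCone X Y)
    (hτ : τ ∈ separableCone X Y) : σ + τ ∈ separableCone X Y := by
  obtain ⟨c, hc, s, hs, rfl⟩ := hσ
  obtain ⟨d, hd, t, ht, rfl⟩ := hτ
  rcases (add_nonneg hc hd).eq_or_lt with h | h
  · obtain ⟨rfl, rfl⟩ : c = 0 ∧ d = 0 := by constructor <;> linarith
    exact ⟨0, le_rfl, s, hs, by simp⟩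
  · refine ⟨c + d, h.le, (c / (c + d)) • s + (d / (c + d)) • t,
      convex_convexHull ℝ _ hs ht (by positivity) (by positivity) (by field_simp), ?_⟩
    rw [smul_add, smul_smul, smul_smul, mul_div_cancel₀ _ h.ne', mul_div_cancel₀ _ h.ne']

theorem separableCone_smul {c : ℝ} (hc : 0 ≤ c) {τ : Matrix (X × Y) (X × Y) ℂ}
    (hτ : τ ∈ separableCone X Y) : c • τ ∈ separableCone X Y := by
  obtain ⟨d, hd, t, ht, rfl⟩ := hτ
  exact ⟨c * d, mul_nonneg hc hd, t, ht, smul_smul _ _ _⟩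

theorem mem_separableStates_of_cone {τ : Matrix (X × Y) (X × Y) ℂ} (h : τ ∈ separableCone X Y)
    (htr : τ.trace = 1) : τ ∈ separableStates X Y := by
  obtain ⟨c, hc, s, hs, rfl⟩ := h
  rw [Matrix.trace_smul, (isDensity_isPPT_of_separable hs).1.2, Complex.real_smul, mul_one] at htr
  rw [show c = 1 by exact_mod_cast htr, one_smul]
  exact hs

/-! ### Separable operators around the identity -/

variable [DecidableEq X] [DecidableEq Y]

theorem exists_isDensity (n : Type) [Fintype n] [DecidableEq n] [Nonempty n] :
    ∃ α : Matrix n n ℂ, IsDensity α := by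
  obtain ⟨i⟩ := ‹Nonempty n›
  refine ⟨Matrix.diagonal (Pi.single i 1), Matrix.PosSemidef.diagonal ?_, ?_⟩
  · exact Pi.single_nonneg.mpr zero_le_one
  · simp [Matrix.trace_diagonal]

theorem exists_eq_smul_isDensity {n : Type} [Fintype n] [DecidableEq n] [Nonempty n]
    {M : Matrix n n ℂ} (hM : M.PosSemidef) :
    ∃ (c : ℝ) (α : Matrix n n ℂ), 0 ≤ c ∧ IsDensity α ∧ M = c • α := by
  have h0 := Complex.le_def.mp hM.trace_nonneg
  have htr : M.trace = (M.trace.re : ℂ) := Complex.ext rfl h0.2.symm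
  rcases h0.1.eq_or_lt with h | h
  · obtain ⟨α, hα⟩ := exists_isDensity n
    refine ⟨0, α, le_rfl, hα, ?_⟩
    rw [zero_smul]
    refine hM.trace_eq_zero_iff.mp ?_
    rw [htr, ← h, Complex.zero_re, Complex.ofReal_zero]
  · rw [Complex.zero_re] at h
    refine ⟨M.trace.re, M.trace.re⁻¹ • M, h.le,
      ⟨posSemidef_real_smul hM (inv_nonneg.mpr h.le), ?_⟩, ?_⟩
    · rw [Matrix.trace_smul, Complex.real_smul]
      nth_rw 2 [htr]
      rw [← Complex.ofReal_mul, inv_mul_cancel₀ h.ne', Complex.ofReal_one]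
    · rw [smul_smul, mul_inv_cancel₀ h.ne', one_smul]

theorem kronecker_mem_separableCone [Nonempty X] [Nonempty Y] {α : Matrix X X ℂ}
    {β : Matrix Y Y ℂ} (hα : α.PosSemidef) (hβ : β.PosSemidef) : α ⊗ₖ β ∈ separableCone X Y := by
  obtain ⟨a, α', ha, hα', rfl⟩ := exists_eq_smul_isDensity hα
  obtain ⟨b, β', hb, hβ', rfl⟩ := exists_eq_smul_isDensity hβ
  refine ⟨a * b, mul_nonneg ha hb, α' ⊗ₖ β', subset_convexHull ℝ _ ⟨α', β', hα', hβ', rfl⟩, ?_⟩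
  rw [Matrix.smul_kronecker, Matrix.kronecker_smul, smul_smul]

theorem one_add_single_posSemidef {n : Type} [Fintype n] [DecidableEq n] (i j : n) {a : ℂ}
    (ha : ‖a‖ ≤ 1 / 2) :
    (1 + a • Matrix.single i j 1 + star a • Matrix.single j i 1 : Matrix n n ℂ).PosSemidef := by
  -- Half of v v† has the required off-diagonal terms; it uses 2‖a‖² ≤ 1/2 at i and 1/2 at j, which
  -- leaves a nonnegative diagonal even if i = j.
  set v : n → ℂ := fun k => (if k = i then 2 * a else 0) + (if k = j then 1 else 0) with hv
  have h1 := posSemidef_real_smul (Matrix.posSemidef_vecMulVec_self_star v)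
    (c := 1 / 2) (by norm_num)
  have h2 : (Matrix.diagonal fun k : n => (((1 - (if k = i then 2 * ‖a‖ ^ 2 else 0) -
      (if k = j then 1 / 2 else 0) : ℝ)) : ℂ)).PosSemidef := by
    refine Matrix.PosSemidef.diagonal fun k => ?_
    rw [Pi.zero_apply]
    refine Complex.zero_le_real.mpr ?_
    have : ‖a‖ ^ 2 ≤ (1 / 2) ^ 2 := pow_le_pow_left₀ (norm_nonneg a) ha 2
    split_ifs <;> nlinarith [sq_nonneg ‖a‖]
  convert h1.add h2 using 1
  have hsq : a * star a = ((‖a‖ ^ 2 : ℝ) : ℂ) := by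
    rw [← Complex.normSq_eq_norm_sq]; exact Complex.mul_conj a
  ext k l
  simp only [Matrix.add_apply, Matrix.smul_apply, Matrix.one_apply, Matrix.single_apply,
    Matrix.vecMulVec_apply, Matrix.diagonal_apply, Pi.star_apply, hv, star_add, star_mul',
    apply_ite star, star_zero, star_one, smul_eq_mul, Complex.real_smul, mul_ite, mul_one, mul_zero]
  have h2' : star (2 : ℂ) = 2 := by simp
  rw [h2']
  push_cast
  push_cast at hsq
  by_cases hki : k = i <;> by_cases hkj : k = j <;> by_cases hli : l = i <;>
    by_cases hlj : l = j <;> by_cases hkl : k = l <;> simp_all [eq_comm] <;> ring1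

-- Sum over the fourth roots of unity u of (α + uA + ūA') ⊗ (β + ūB + uB'): every term with a
-- nontrivial power of u cancels.
omit [Fintype X] [Fintype Y] [DecidableEq X] [DecidableEq Y] in
theorem phase_average (α A A' : Matrix X X ℂ) (β B B' : Matrix Y Y ℂ) :
    (α + A + A') ⊗ₖ (β + B + B') + (α - A - A') ⊗ₖ (β - B - B') +
      (α + Complex.I • A - Complex.I • A') ⊗ₖ (β - Complex.I • B + Complex.I • B') +
      (α - Complex.I • A + Complex.I • A') ⊗ₖ (β + Complex.I • B - Complex.I • B') =
    (4 : ℝ) • (α ⊗ₖ β + A ⊗ₖ B + A' ⊗ₖ B') := by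
  ext i j
  simp only [Matrix.add_apply, Matrix.sub_apply, Matrix.smul_apply, Matrix.kroneckerMap_apply,
    smul_eq_mul, Complex.real_smul]
  push_cast
  linear_combination (-2 * (A i.1 j.1 - A' i.1 j.1) * (B i.2 j.2 - B' i.2 j.2)) * Complex.I_sq

/-- By phase averaging this is a mean of four products of positive operators. The coefficient z is
split as 2z times 1/2, so that both factors meet the bound 1/2 of `one_add_single_posSemidef`. -/
theorem one_add_kronecker_single_mem [Nonempty X] [Nonempty Y] (i j : X) (k l : Y) {z : ℂ}
    (hz : ‖z‖ ≤ 1 / 4) :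
    1 + z • (Matrix.single i j (1 : ℂ) ⊗ₖ Matrix.single k l (1 : ℂ)) +
      star z • (Matrix.single j i (1 : ℂ) ⊗ₖ Matrix.single l k (1 : ℂ)) ∈ separableCone X Y := by
  set A := (2 * z) • Matrix.single i j (1 : ℂ) with hA
  set A' := star (2 * z) • Matrix.single j i (1 : ℂ) with hA'
  set B := (1 / 2 : ℂ) • Matrix.single k l (1 : ℂ) with hB
  set B' := (1 / 2 : ℂ) • Matrix.single l k (1 : ℂ) with hB'
  have hX : ∀ u : ℂ, ‖u‖ = 1 → (1 + u • A + star u • A').PosSemidef := fun u hu => by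
    have := one_add_single_posSemidef i j (a := u * (2 * z)) (by
      rw [norm_mul, norm_mul, hu, Complex.norm_ofNat]; linarith)
    simpa only [hA, hA', smul_smul, star_mul'] using this
  have hY : ∀ u : ℂ, ‖u‖ = 1 → (1 + u • B + star u • B').PosSemidef := fun u hu => by
    have := one_add_single_posSemidef k l (a := u * (1 / 2)) (by
      rw [norm_mul, hu]; norm_num)
    simpa [hB, hB', smul_smul, star_mul'] using this
  have key := phase_average (1 : Matrix X X ℂ) A A' (1 : Matrix Y Y ℂ) B B'
  have h1 := kronecker_mem_separableCone (hX 1 (by simp)) (hY 1 (by simp))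
  have h2 := kronecker_mem_separableCone (hX (-1) (by simp)) (hY (-1) (by simp))
  have h3 := kronecker_mem_separableCone (hX Complex.I (by simp)) (hY (-Complex.I) (by simp))
  have h4 := kronecker_mem_separableCone (hX (-Complex.I) (by simp)) (hY Complex.I (by simp))
  have hs := separableCone_smul (c := 1 / 4) (by norm_num) (separableCone_add
    (separableCone_add (separableCone_add h1 h2) h3) h4)
  simp only [star_one, one_smul, star_neg, neg_smul, Complex.star_def, Complex.conj_I, neg_neg,
    ← sub_eq_add_neg] at hs
  rw [key, smul_smul, show (1 / 4 * 4 : ℝ) = 1 by norm_num, one_smul] at hs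
  convert hs using 2
  · rw [Matrix.one_kronecker_one, hA, hB, Matrix.smul_kronecker, Matrix.kronecker_smul, smul_smul]
    congr 2; ring
  · rw [hA', hB', Matrix.smul_kronecker, Matrix.kronecker_smul, smul_smul]
    congr 1
    simp only [star_mul', Complex.star_def, map_ofNat]
    ring

/-- A neighbourhood of the identity consists of separable operators. -/
theorem near_one_mem_separableCone [Nonempty X] [Nonempty Y] {H : Matrix (X × Y) (X × Y) ℂ}
    (hH : H.IsHermitian) (hsmall : ∀ i j, ‖H i j‖ ≤ 1 / 4) :
    ((Fintype.card (X × Y) : ℝ) ^ 2) • (1 : Matrix (X × Y) (X × Y) ℂ) + (2 : ℝ) • H ∈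
      separableCone X Y := by
  have hsum : ∀ (s : Finset ((X × Y) × (X × Y)))
      (f : (X × Y) × (X × Y) → Matrix (X × Y) (X × Y) ℂ),
      s.Nonempty → (∀ i, f i ∈ separableCone X Y) → ∑ i ∈ s, f i ∈ separableCone X Y := by
    intro s f hs hf
    induction hs using Finset.Nonempty.cons_induction with
    | singleton a => simpa using hf a
    | cons a s ha hs ih => rw [Finset.sum_cons]; exact separableCone_add (hf a) ih
  have := hsum Finset.univ _ Finset.univ_nonempty fun q =>
    one_add_kronecker_single_mem q.1.1 q.2.1 q.1.2 q.2.2 (hsmall q.1 q.2)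
  convert this using 1
  -- One separable operator is taken for each matrix entry. Their identities add up to the square of
  -- the dimension, and each of the two off-diagonal families adds up to H.
  have e1 : ∑ q : (X × Y) × (X × Y), H q.1 q.2 •
      (Matrix.single q.1.1 q.2.1 (1 : ℂ) ⊗ₖ Matrix.single q.1.2 q.2.2 (1 : ℂ)) = H := by
    conv_rhs => rw [Matrix.matrix_eq_sum_single H, ← Fintype.sum_prod_type']
    refine Finset.sum_congr rfl fun q _ => ?_
    rw [Matrix.single_kronecker_single, Matrix.smul_single]
    simp
  have e2 : ∑ q : (X × Y) × (X × Y), star (H q.1 q.2) •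
      (Matrix.single q.2.1 q.1.1 (1 : ℂ) ⊗ₖ Matrix.single q.2.2 q.1.2 (1 : ℂ)) = H := by
    conv_rhs => rw [← e1, ← (Equiv.prodComm _ _).sum_comp]
    refine Finset.sum_congr rfl fun q _ => ?_
    rw [hH.apply]
    rfl
  rw [Finset.sum_add_distrib, Finset.sum_add_distrib, e1, e2, Finset.sum_const, Finset.card_univ,
    Fintype.card_prod, add_assoc, two_smul, ← Nat.cast_smul_eq_nsmul ℝ]
  congr 2
  simp only [Fintype.card_prod]
  push_cast
  ring

/-! ## The witness states -/

theorem phiPlus_posSemidef : phiPlus.PosSemidef := by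
  have := posSemidef_real_smul (Matrix.posSemidef_vecMulVec_self_star
    fun i : Fin 2 × Fin 2 => if i.1 = i.2 then (1 : ℂ) else 0) (c := 1 / 2) (by norm_num)
  convert this using 1
  ext i j
  by_cases h1 : i.1 = i.2 <;> by_cases h2 : j.1 = j.2 <;>
    simp [phiPlus, Matrix.vecMulVec_apply, h1, h2]

theorem witnessState_trace (p : ℝ) : (witnessState p).trace = 1 := by
  simp only [Matrix.trace, witnessState, phiPlus, Matrix.diag, Fintype.sum_prod_type,
    Fin.sum_univ_two, Matrix.add_apply, Matrix.smul_apply, Matrix.of_apply, Matrix.one_apply]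
  norm_num
  ring

theorem cutABC_isDensity {A B C : Type} [Fintype A] [Fintype B] [Fintype C]
    {ρ : Matrix (A × B × C) (A × B × C) ℂ} : IsDensity (cutABC ρ) ↔ IsDensity ρ := by
  have h1 : cutABC ρ = ρ.submatrix (Equiv.prodAssoc A B C) (Equiv.prodAssoc A B C) := rfl
  have h2 : (cutABC ρ).trace = ρ.trace := (Equiv.prodAssoc A B C).sum_comp fun i => ρ i i
  refine ⟨fun h => ⟨?_, h2.symm.trans h.2⟩, fun h => ⟨?_, h2.trans h.2⟩⟩
  · have := h.1
    rwa [h1, Matrix.posSemidef_submatrix_equiv] at this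
  · rw [h1]
    exact h.1.submatrix _

/-- The first term of the witness states. -/
noncomputable abbrev witnessPure : Matrix (Fin 2 × Fin 2 × Fin 2) (Fin 2 × Fin 2 × Fin 2) ℂ :=
  Matrix.of (fun i j => phiPlus (i.1, i.2.1) (j.1, j.2.1) *
    (if i.2.2 = 0 ∧ j.2.2 = 0 then 1 else 0))

theorem cutABC_witnessPure_mem :
    cutABC witnessPure ∈ separableCone (Fin 2 × Fin 2) (Fin 2) := by
  have : cutABC witnessPure = phiPlus ⊗ₖ Matrix.diagonal (Pi.single 0 1) := by
    ext ⟨⟨a, b⟩, c⟩ ⟨⟨a', b'⟩, c'⟩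
    fin_cases c <;> fin_cases c' <;> simp [cutABC, Matrix.diagonal]
  rw [this]
  refine kronecker_mem_separableCone phiPlus_posSemidef (Matrix.PosSemidef.diagonal ?_)
  exact Pi.single_nonneg.mpr zero_le_one

theorem witnessState_isHermitian (p : ℝ) : (witnessState p).IsHermitian := by
  ext i j
  by_cases h : i = j
  · subst h
    simp [witnessState, phiPlus, apply_ite star]
  · simp [witnessState, phiPlus, h, Ne.symm h, apply_ite star, and_comm]

/-- A neighbourhood of a witness state consists of `AB : C`-separable states. -/
theorem eventually_separable {p : ℝ} (h0 : 0 < p) (h1 : p ≤ 1) :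
    ∀ᶠ σ in 𝓝[hermitianTraceOne (Fin 2 × Fin 2 × Fin 2)] (witnessState p),
      cutABC σ ∈ separableStates (Fin 2 × Fin 2) (Fin 2) := by
  have hclose : ∀ᶠ σ in 𝓝[hermitianTraceOne (Fin 2 × Fin 2 × Fin 2)] (witnessState p),
      ∀ i j, ‖σ i j - witnessState p i j‖ < p / 1024 := by
    refine eventually_all.mpr fun i => eventually_all.mpr fun j => ?_
    have hc : Continuous fun σ : Matrix (Fin 2 × Fin 2 × Fin 2) (Fin 2 × Fin 2 × Fin 2) ℂ =>
        ‖σ i j - witnessState p i j‖ :=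
      ((continuous_apply_apply i j).sub continuous_const).norm
    refine (hc.continuousWithinAt.tendsto).eventually_lt_const ?_
    rw [sub_self, norm_zero]
    positivity
  filter_upwards [hclose, self_mem_nhdsWithin] with σ hσ hmem
  refine mem_separableStates_of_cone ?_
    (((Equiv.prodAssoc _ _ _).sum_comp fun i => σ i i).trans hmem.2)
  -- With weight p/512, the combination 64·1 + 2H contributes exactly (p/8)·1 plus the perturbation.
  -- The radius p/1024 makes the entries of H at most 1/4.
  set H : Matrix ((Fin 2 × Fin 2) × Fin 2) ((Fin 2 × Fin 2) × Fin 2) ℂ :=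
    (256 / p : ℝ) • cutABC (σ - witnessState p) with hH
  have hHerm : H.IsHermitian := by
    have : (σ - witnessState p).IsHermitian := hmem.1.sub (witnessState_isHermitian p)
    ext i j
    rw [hH, Matrix.conjTranspose_apply, Matrix.smul_apply, Matrix.smul_apply, star_smul,
      star_trivial]
    exact congrArg _ (this.apply _ _)
  have hsmall : ∀ i j, ‖H i j‖ ≤ 1 / 4 := by
    intro i j
    rw [hH, Matrix.smul_apply, norm_smul, Real.norm_of_nonneg (by positivity)]
    calc _ ≤ 256 / p * (p / 1024) :=
          mul_le_mul_of_nonneg_left (hσ _ _).le (by positivity)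
      _ = 1 / 4 := by field_simp; norm_num
  have hmix := separableCone_add
    (separableCone_smul (c := 1 - p) (by linarith) cutABC_witnessPure_mem)
    (separableCone_smul (c := p / 512) (by positivity) (near_one_mem_separableCone hHerm hsmall))
  convert hmix using 1
  have hcard : (Fintype.card ((Fin 2 × Fin 2) × Fin 2) : ℝ) ^ 2 = 64 := by
    norm_num [Fintype.card_prod]
  rw [hcard, smul_add, smul_smul, smul_smul, hH, smul_smul]
  have e : p / 512 * 2 * (256 / p) = 1 := by field_simp; norm_num
  rw [e, one_smul]
  ext i j
  have h1 : (1 : Matrix (Fin 2 × Fin 2 × Fin 2) (Fin 2 × Fin 2 × Fin 2) ℂ)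
      (i.1.1, i.1.2, i.2) (j.1.1, j.1.2, j.2) =
      (1 : Matrix ((Fin 2 × Fin 2) × Fin 2) ((Fin 2 × Fin 2) × Fin 2) ℂ) i j := by
    simp [Matrix.one_apply, Prod.ext_iff, and_assoc]
  simp only [cutABC, Matrix.of_apply, Matrix.add_apply, Matrix.sub_apply, Matrix.smul_apply,
    witnessState, h1, Complex.real_smul, smul_eq_mul]
  push_cast
  ring

end Separable

/-! ## Tensor powers and maximally entangled states -/

section TensorPower

/-- Tensor power of an operator, with the copies indexed by `ι`. -/
noncomputable def tensorPower (ι : Type) [Fintype ι] {X : Type} (M : Matrix X X ℂ) :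
    Matrix (ι → X) (ι → X) ℂ :=
  Matrix.of fun x y => ∏ i, M (x i) (y i)

theorem tensorPower_posSemidef (ι : Type) [Fintype ι] [DecidableEq ι] {X : Type} [Fintype X] {M : Matrix X X ℂ}
    (hM : M.PosSemidef) : (tensorPower ι M).PosSemidef := by
  classical
  open scoped MatrixOrder in
  obtain ⟨B, rfl⟩ := CStarAlgebra.nonneg_iff_eq_star_mul_self.mp hM.nonneg
  convert Matrix.posSemidef_conjTranspose_mul_self (tensorPower ι B) using 1
  ext x y
  simp only [tensorPower, Matrix.of_apply, Matrix.mul_apply, Matrix.conjTranspose_apply,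
    Matrix.star_apply, star_prod, ← Finset.prod_mul_distrib, Finset.prod_univ_sum,
    Fintype.piFinset_univ]

theorem tensorPower_trace (ι : Type) [Fintype ι] [DecidableEq ι] {X : Type} [Fintype X]
    (M : Matrix X X ℂ) : (tensorPower ι M).trace = M.trace ^ Fintype.card ι := by
  classical
  have := Finset.prod_univ_sum (fun _ : ι => (Finset.univ : Finset X)) fun _ x => M x x
  rw [Fintype.piFinset_univ, Finset.prod_const, Finset.card_univ] at this
  exact this.symm

/-- The tensor power of a bipartite operator, with the copies indexed by `ι`. -/
noncomputable def pairPower (ι : Type) [Fintype ι] {X Y : Type} (τ : Matrix (X × Y) (X × Y) ℂ) :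
    Matrix ((ι → X) × (ι → Y)) ((ι → X) × (ι → Y)) ℂ :=
  Matrix.of fun x y => ∏ i, τ (x.1 i, x.2 i) (y.1 i, y.2 i)

theorem pairPower_isDensity (ι : Type) [Fintype ι] [DecidableEq ι] {X Y : Type} [Fintype X]
    [Fintype Y] {τ : Matrix (X × Y) (X × Y) ℂ} (hτ : IsDensity τ) :
    IsDensity (pairPower ι τ) := by
  refine ⟨(tensorPower_posSemidef ι hτ.1).submatrix fun (x : (ι → X) × (ι → Y)) i => (x.1 i, x.2 i), ?_⟩
  have := ((Equiv.arrowProdEquivProdArrow ι (fun _ => X) (fun _ => Y)).symm.sum_comp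
    fun x => tensorPower ι τ x x).trans (tensorPower_trace ι τ)
  rwa [hτ.2, one_pow] at this

/-- The maximally entangled state `d⁻¹ ∑ |aa⟩⟨bb|`. -/
noncomputable def maxEntangled (U : Type) [Fintype U] [DecidableEq U] :
    Matrix (U × U) (U × U) ℂ :=
  Matrix.of fun i j => if i.1 = i.2 ∧ j.1 = j.2 then (Fintype.card U : ℂ)⁻¹ else 0

theorem pairPower_phiPlus (ι : Type) [Fintype ι] [DecidableEq ι] :
    pairPower ι phiPlus = maxEntangled (ι → Fin 2) := by
  ext i j
  simp only [pairPower, phiPlus, maxEntangled, Matrix.of_apply, Finset.prod_ite_zero]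
  simp [funext_iff, forall_and]

/-! ### Overlap with the maximally entangled state -/

variable {U : Type} [Fintype U] [DecidableEq U]

theorem trace_mul_maxEntangled (τ : Matrix (U × U) (U × U) ℂ) :
    (τ * maxEntangled U).trace = (Fintype.card U : ℂ)⁻¹ * ∑ a, ∑ b, τ (a, a) (b, b) := by
  simp only [Matrix.trace, Matrix.diag, Matrix.mul_apply, maxEntangled, Matrix.of_apply,
    Fintype.sum_prod_type, ite_and, Finset.mul_sum]
  simp [mul_comm]

theorem maxEntangled_isHermitian : (maxEntangled U).IsHermitian := by
  ext i j
  simp [maxEntangled, apply_ite star, and_comm]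

theorem maxEntangled_mul_self [Nonempty U] : maxEntangled U * maxEntangled U = maxEntangled U := by
  ext i j
  simp only [Matrix.mul_apply, maxEntangled, Matrix.of_apply, Fintype.sum_prod_type]
  by_cases h1 : i.1 = i.2 <;> by_cases h2 : j.1 = j.2 <;> simp [h1, h2]

theorem maxEntangled_posSemidef [Nonempty U] : (maxEntangled U).PosSemidef := by
  rw [← maxEntangled_mul_self]
  nth_rw 1 [← (maxEntangled_isHermitian (U := U)).eq]
  exact Matrix.posSemidef_conjTranspose_mul_self _

theorem one_sub_maxEntangled_posSemidef [Nonempty U] : (1 - maxEntangled U).PosSemidef := by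
  have h : (1 - maxEntangled U) = (1 - maxEntangled U)ᴴ * (1 - maxEntangled U) := by
    rw [Matrix.conjTranspose_sub, Matrix.conjTranspose_one, maxEntangled_isHermitian.eq,
      Matrix.sub_mul, Matrix.mul_sub, Matrix.mul_sub, maxEntangled_mul_self]
    simp
  rw [h]
  exact Matrix.posSemidef_conjTranspose_mul_self _

theorem maxEntangled_trace [Nonempty U] : (maxEntangled U).trace = 1 := by
  simp [Matrix.trace, maxEntangled, Fintype.sum_prod_type]

/-- A PPT operator has overlap at most `d⁻¹` with the maximally entangled state. -/
theorem re_overlap_le_of_isPPT {τ : Matrix (U × U) (U × U) ℂ} (h : IsPPT τ) :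
    ((τ * maxEntangled U).trace).re ≤ (Fintype.card U : ℝ)⁻¹ * τ.trace.re := by
  set P := partialTranspose τ with hP
  -- The overlap is d⁻¹ Tr(P·SWAP), and SWAP ≤ 1. This is the inequality on the antisymmetric vector
  -- |ab⟩ - |ba⟩; summing over a and b gives the claim.
  have key : ∀ a b, 0 ≤ (P (a, b) (a, b)).re - (P (a, b) (b, a)).re - (P (b, a) (a, b)).re +
      (P (b, a) (b, a)).re := by
    intro a b
    have := (Complex.le_def.mp (Matrix.PosSemidef.dotProduct_mulVec_nonneg h
      (Pi.single (a, b) 1 - Pi.single (b, a) 1))).1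
    rw [Matrix.mulVec_sub, star_sub, sub_dotProduct, dotProduct_sub, dotProduct_sub] at this
    simp only [Pi.star_single, star_one, Matrix.mulVec_single_one, single_one_dotProduct,
      Complex.sub_re, Complex.zero_re, Matrix.col_apply, ← hP] at this
    linarith
  have hsum := Finset.sum_nonneg fun a (_ : a ∈ Finset.univ) =>
    Finset.sum_nonneg fun b (_ : b ∈ Finset.univ) => key a b
  simp only [Finset.sum_add_distrib, Finset.sum_sub_distrib] at hsum
  rw [Finset.sum_comm (f := fun a b => (P (b, a) (a, b)).re),
    Finset.sum_comm (f := fun a b => (P (b, a) (b, a)).re)] at hsum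
  have htr : τ.trace.re = ∑ a, ∑ b, (P (a, b) (a, b)).re := by
    simp [Matrix.trace, Fintype.sum_prod_type, hP, partialTranspose]
  have hov : (∑ a, ∑ b, τ (a, a) (b, b)).re = ∑ a, ∑ b, (P (a, b) (b, a)).re := by
    simp [hP, partialTranspose]
  have hc : ((Fintype.card U : ℂ)⁻¹ : ℂ) = ((Fintype.card U : ℝ)⁻¹ : ℝ) := by push_cast; rfl
  rw [trace_mul_maxEntangled, hc, Complex.re_ofReal_mul, hov, htr]
  refine mul_le_mul_of_nonneg_left ?_ (by positivity)
  linarith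

/-- The left side is Tr((τ - Φ)(1 - Φ)), with Φ the maximally entangled projection. -/
theorem one_sub_re_overlap_le [Nonempty U] {τ : Matrix (U × U) (U × U) ℂ} (h : IsDensity τ) :
    1 - ((τ * maxEntangled U).trace).re ≤ 2 * traceDist τ (maxEntangled U) := by
  have := re_trace_mul_le_traceNorm (h.1.1.sub maxEntangled_isHermitian)
    one_sub_maxEntangled_posSemidef (by rw [sub_sub_cancel]; exact maxEntangled_posSemidef (U := U))
  rw [Matrix.mul_sub, Matrix.mul_one, Matrix.sub_mul, maxEntangled_mul_self, Matrix.trace_sub,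
    Matrix.trace_sub, Matrix.trace_sub, h.2, maxEntangled_trace] at this
  rw [traceDist]
  simp only [Complex.sub_re, Complex.one_re] at this
  linarith

end TensorPower

/-! ## Vanishing of the merging fidelity -/

section Merging

variable {A B C : Type} [Fintype A] [DecidableEq A] [Fintype B] [DecidableEq B] [Fintype C]
  [DecidableEq C]

/-- Merging is one LOCC protocol between A with Bob and Charlie, followed by discarding Bob's system
and the ancillas; it starts from a PPT state. -/
theorem mergedState_isDensity_isPPT {ρ : Matrix (A × B × C) (A × B × C) ℂ} (hρ : IsDensity ρ)
    (hppt : IsPPT (cutABC ρ)) {κ : Matrix B B ℂ} (hκ : IsDensity κ)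
    {Θ : Matrix (B × (C × B)) (B × (C × B)) ℂ → Matrix (B × (C × B)) (B × (C × B)) ℂ}
    (hΘ : IsPPTAssistedLOCC Θ) :
    IsDensity (traceBob (idTensor A Θ (withRegister ρ κ))) ∧
      IsPPT (traceBob (idTensor A Θ (withRegister ρ κ))) := by
  obtain ⟨s, t, μ, Λ, hμ, hμ', hΛ, hΘ'⟩ := hΘ
  -- A sits with Bob as a spectator; Charlie's spectator is trivial.
  let e : (((B × Fin s) × A) × (((C × B) × Fin t) × Unit)) ≃
      ((A × B × C) × B) × (Fin s × Fin t) :=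
    { toFun := fun i => (((i.1.2, i.1.1.1, i.2.1.1.1), i.2.1.1.2), (i.1.1.2, i.2.1.2))
      invFun := fun i => (((i.1.1.2.1, i.2.1), i.1.1.1), (((i.1.1.2.2, i.1.2), i.2.2), ()))
      left_inv := fun _ => rfl
      right_inv := fun _ => rfl }
  set ω := ((ρ ⊗ₖ κ) ⊗ₖ μ).submatrix e e with hω
  have h1 : IsDensity ω := by
    refine ⟨((hρ.1.kronecker hκ.1).kronecker hμ.1).submatrix e, ?_⟩
    refine (e.sum_comp fun i => ((ρ ⊗ₖ κ) ⊗ₖ μ) i i).trans ?_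
    change ((ρ ⊗ₖ κ) ⊗ₖ μ).trace = 1
    rw [Matrix.trace_kronecker, Matrix.trace_kronecker, hρ.2, hκ.2, hμ.2, one_mul, one_mul]
  have h2 : IsPPT ω := by
    -- Up to relabelling, the partial transpose is the tensor product of those of ρ and μ with the
    -- transpose of κ.
    have h : IsPPT (cutABC ρ) → IsPPT μ → _ := fun h h' =>
      (((h.submatrix (Equiv.prodAssoc A B C).symm).kronecker hκ.1.transpose).kronecker h').submatrix e
    exact h hppt hμ'
  have hL := (IsLOCC.discard (Equiv.prodComm (B × Fin s) A)
    (Equiv.prodAssoc (C × B) (Fin t) Unit)).comp (hΛ.tensorId (S := A) (T := Unit))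
  have heq : traceBob (idTensor A Θ (withRegister ρ κ)) = (Matrix.of fun i j : A × (C × B) =>
      ∑ p, ∑ q, tensorId A Unit Λ ω
        ((Equiv.prodComm (B × Fin s) A).symm (i.1, p),
          (Equiv.prodAssoc (C × B) (Fin t) Unit).symm (i.2, q))
        ((Equiv.prodComm (B × Fin s) A).symm (j.1, p),
          (Equiv.prodAssoc (C × B) (Fin t) Unit).symm (j.2, q))) := by
    ext i j
    simp only [traceBob, idTensor, Matrix.of_apply, hΘ', traceAncilla, Fintype.sum_prod_type,
      Finset.univ_unique, Finset.sum_singleton]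
    rfl
  rw [heq]
  exact ⟨hL.isDensity h1, hL.isPPT h2⟩

/-- If the target state can be transformed by LOCC into a state close to a maximally entangled
state, then its fidelity with PPT states is small. -/
theorem fidelity_le_of_isPPT {Z Y U : Type} [Fintype Z] [DecidableEq Z] [Fintype Y] [DecidableEq Y]
    [Fintype U] [DecidableEq U] [Nonempty U] {ω τ : Matrix (A × Z) (A × Z) ℂ}
    (hω : IsDensity ω) (hω' : IsPPT ω) (hτ : IsDensity τ) (e : Y ≃ Z)
    {Λ : Matrix (A × Y) (A × Y) ℂ → Matrix (U × U) (U × U) ℂ} (hΛ : IsLOCC Λ) :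
    fidelity ω τ ≤ √(Fintype.card U : ℝ)⁻¹ +
      √(2 * traceDist (Λ (τ.submatrix (Prod.map id e) (Prod.map id e))) (maxEntangled U)) := by
  have hΛ' := hΛ.comp (IsLOCC.relabel (Equiv.refl A) e)
  let f : Matrix (A × Z) (A × Z) ℂ →ₗ[ℂ] ℂ :=
    Matrix.traceLinearMap _ ℂ ℂ ∘ₗ LinearMap.mulRight ℂ (maxEntangled U) ∘ₗ hΛ'.isLinearMap.mk'
  have hf : ∀ τ, f τ =
      (Λ (τ.submatrix (Prod.map id e) (Prod.map id e)) * maxEntangled U).trace := fun _ => rfl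
  have hpos : ∀ τ : Matrix (A × Z) (A × Z) ℂ, τ.PosSemidef → 0 ≤ f τ := fun τ h =>
    trace_mul_nonneg (hΛ'.posSemidef h) maxEntangled_posSemidef
  have hle : ∀ τ : Matrix (A × Z) (A × Z) ℂ, τ.PosSemidef → f τ ≤ τ.trace := fun τ h => by
    have := trace_mul_nonneg (hΛ'.posSemidef h) (one_sub_maxEntangled_posSemidef (U := U))
    rw [Matrix.mul_sub, Matrix.mul_one, Matrix.trace_sub, hΛ'.trace_eq, sub_nonneg] at this
    exact this
  refine (fidelity_le hω.1 hτ.1 f hpos hle).trans ?_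
  rw [hω.2, hτ.2, Complex.one_re]
  have hb : ∀ τ : Matrix (A × Z) (A × Z) ℂ, IsDensity τ → 0 ≤ (f τ).re ∧ (f τ).re ≤ 1 :=
    fun τ h => by
      have h1 := (Complex.le_def.mp (hpos τ h.1)).1
      have h2 := (Complex.le_def.mp (hle τ h.1)).1
      rw [h.2] at h2
      exact ⟨h1, h2⟩
  have h1 : (f ω).re ≤ (Fintype.card U : ℝ)⁻¹ := by
    have := re_overlap_le_of_isPPT (hΛ'.isPPT hω')
    rw [hΛ'.trace_eq, hω.2, Complex.one_re, mul_one] at this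
    exact this
  have h2 := one_sub_re_overlap_le (hΛ'.isDensity hτ)
  have h3 : √(f ω).re * √(f τ).re ≤ √(Fintype.card U : ℝ)⁻¹ * 1 :=
    mul_le_mul (Real.sqrt_le_sqrt h1) (Real.sqrt_le_one.mpr (hb τ hτ).2) (Real.sqrt_nonneg _)
      (Real.sqrt_nonneg _)
  have h4 : √(1 - (f ω).re) * √(1 - (f τ).re) ≤ 1 *
      √(2 * traceDist (Λ (τ.submatrix (Prod.map id e) (Prod.map id e))) (maxEntangled U)) :=
    mul_le_mul (Real.sqrt_le_one.mpr (by linarith [(hb ω hω).1])) (Real.sqrt_le_sqrt h2)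
      (Real.sqrt_nonneg _) zero_le_one
  linarith

/-- The asymptotic fidelity of PPT merging vanishes for `AB : C`-PPT states which are distillable
in the bipartition `A : BC`. -/
theorem hasAsymptoticFidelity_zero {ρ : Matrix (A × B × C) (A × B × C) ℂ} (hρ : IsDensity ρ)
    (hppt : IsPPT (cutABC ρ)) {r : ℝ≥0} (hr : 0 < r) (hrate : IsDistillationRate ρ r) :
    HasAsymptoticFidelity ρ 0 := by
  obtain ⟨Λ, hΛ, hlim⟩ := hrate
  set k : ℕ → ℕ := fun n => ⌊n * r⌋₊ with hk
  have hktop : Tendsto k atTop atTop := by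
    refine tendsto_nat_floor_atTop.comp ?_
    exact tendsto_natCast_atTop_atTop.atTop_mul_const hr
  have hbound : ∀ n, mergingFidelity (tensorPow₃ ρ n) ≤ √((2 ^ k n : ℝ)⁻¹) +
      √(2 * traceDist (Λ n (tensorPow₂ ρ n)) (tensorPow₂ phiPlus (k n))) := by
    intro n
    refine Real.sSup_le ?_ (add_nonneg (Real.sqrt_nonneg _) (Real.sqrt_nonneg _))
    rintro _ ⟨κ, Θ, hκ, hΘ, rfl⟩
    have hpow : IsDensity (tensorPow₂ ρ n) := pairPower_isDensity (Fin n) hρ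
    have hσ : IsDensity (tensorPow₃ ρ n) := by
      refine ⟨hpow.1.submatrix fun x : (Fin n → A) × (Fin n → B) × (Fin n → C) =>
        (x.1, fun i => (x.2.1 i, x.2.2 i)), ?_⟩
      refine Eq.trans ?_ hpow.2
      exact ((Equiv.refl _).prodCongr (Equiv.arrowProdEquivProdArrow (Fin n) (fun _ => B)
        (fun _ => C)).symm).sum_comp fun x => tensorPow₂ ρ n x x
    have hσ' : IsPPT (cutABC (tensorPow₃ ρ n)) :=
      (tensorPower_posSemidef (Fin n) hppt).submatrix
        fun (x : ((Fin n → A) × (Fin n → B)) × (Fin n → C)) i => ((x.1.1 i, x.1.2 i), x.2 i)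
    obtain ⟨h1, h2⟩ := mergedState_isDensity_isPPT hσ hσ' hκ hΘ
    -- The target lists all copies of C before the register, whereas the protocol expects n copies
    -- of BC.
    let e : (Fin n → B × C) ≃ (Fin n → C) × (Fin n → B) :=
      (Equiv.arrowProdEquivProdArrow (Fin n) (fun _ => B) (fun _ => C)).trans (Equiv.prodComm _ _)
    have ht : IsDensity (targetState (tensorPow₃ ρ n)) := by
      refine ⟨hσ.1.submatrix fun x : (Fin n → A) × ((Fin n → C) × (Fin n → B)) =>
        (x.1, x.2.2, x.2.1), Eq.trans ?_ hσ.2⟩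
      exact ((Equiv.refl _).prodCongr (Equiv.prodComm _ _)).sum_comp fun x => tensorPow₃ ρ n x x
    have := fidelity_le_of_isPPT h1 h2 ht e (hΛ n)
    rw [← pairPower_phiPlus] at this
    refine this.trans (le_of_eq ?_)
    congr 2
    simp [hk]
  have hnonneg : ∀ n, 0 ≤ mergingFidelity (tensorPow₃ ρ n) := fun n =>
    Real.sSup_nonneg (by rintro _ ⟨κ, Θ, hκ, hΘ, rfl⟩; exact fidelity_nonneg _ _)
  refine squeeze_zero hnonneg hbound ?_
  have h1 : Tendsto (fun n => √((2 ^ k n : ℝ)⁻¹)) atTop (𝓝 0) := by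
    have : Tendsto (fun n => (2 ^ k n : ℝ)⁻¹) atTop (𝓝 0) :=
      tendsto_inv_atTop_zero.comp ((tendsto_pow_atTop_atTop_of_one_lt one_lt_two).comp hktop)
    simpa using this.sqrt
  have h2 := (hlim.const_mul 2).sqrt
  simpa using h1.add h2

end Merging

/-! ## LOCC on many copies -/

section ManyCopies

variable {X Y X' Y' : Type}
  [Fintype X] [DecidableEq X] [Fintype Y] [DecidableEq Y]
  [Fintype X'] [DecidableEq X'] [Fintype Y'] [DecidableEq Y']

omit [Fintype X] [DecidableEq X] [Fintype Y] [DecidableEq Y] in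
theorem pairPower_submatrix_arrowCongr {ι κ : Type} [Fintype ι] [Fintype κ] (e : ι ≃ κ)
    (τ : Matrix (X × Y) (X × Y) ℂ) :
    (pairPower κ τ).submatrix (Prod.map (e.arrowCongr (Equiv.refl X)) (e.arrowCongr (Equiv.refl Y)))
      (Prod.map (e.arrowCongr (Equiv.refl X)) (e.arrowCongr (Equiv.refl Y))) = pairPower ι τ := by
  ext i j
  simp only [pairPower, Matrix.submatrix_apply, Matrix.of_apply]
  rw [← e.prod_comp]
  simp

/-- One copy is processed at a time, the others being spectators. By linearity the tensor factor
carried by the spectators comes out as a scalar, entry by entry. -/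
theorem exists_isLOCC_pairPower_fin
    {Λ : Matrix (X × Y) (X × Y) ℂ → Matrix (X' × Y') (X' × Y') ℂ} (hΛ : IsLOCC Λ) (K : ℕ) :
    ∃ Ξ : Matrix ((Fin K → X) × (Fin K → Y)) ((Fin K → X) × (Fin K → Y)) ℂ →
        Matrix ((Fin K → X') × (Fin K → Y')) ((Fin K → X') × (Fin K → Y')) ℂ,
      IsLOCC Ξ ∧ ∀ τ, Ξ (pairPower (Fin K) τ) = pairPower (Fin K) (Λ τ) := by
  induction K with
  | zero =>
    refine ⟨_, IsLOCC.relabel (Equiv.ofUnique _ _) (Equiv.ofUnique _ _), fun τ => ?_⟩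
    ext i j
    simp [pairPower]
  | succ K ih =>
    obtain ⟨Ξ, hΞ, h⟩ := ih
    refine ⟨_, (IsLOCC.relabel (Fin.consEquiv fun _ => X').symm (Fin.consEquiv fun _ => Y').symm).comp
      ((IsLOCC.relabel (Equiv.prodComm _ _) (Equiv.prodComm _ _)).comp
      ((hΞ.tensorId (S := X') (T := Y')).comp
      ((IsLOCC.relabel (Equiv.prodComm _ _) (Equiv.prodComm _ _)).comp
      ((hΛ.tensorId (S := Fin K → X) (T := Fin K → Y)).comp
      (IsLOCC.relabel (Fin.consEquiv fun _ => X) (Fin.consEquiv fun _ => Y)))))), fun τ => ?_⟩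
    have h1 : tensorId (Fin K → X) (Fin K → Y) Λ ((pairPower (Fin (K + 1)) τ).submatrix
        (Prod.map (Fin.consEquiv fun _ => X) (Fin.consEquiv fun _ => Y))
        (Prod.map (Fin.consEquiv fun _ => X) (Fin.consEquiv fun _ => Y))) =
        Matrix.of fun i j => Λ τ (i.1.1, i.2.1) (j.1.1, j.2.1) *
          pairPower (Fin K) τ (i.1.2, i.2.2) (j.1.2, j.2.2) := by
      ext i j
      have : (Matrix.of fun p q : X × Y => (pairPower (Fin (K + 1)) τ).submatrix
          (Prod.map (Fin.consEquiv fun _ => X) (Fin.consEquiv fun _ => Y))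
          (Prod.map (Fin.consEquiv fun _ => X) (Fin.consEquiv fun _ => Y))
          ((p.1, i.1.2), (p.2, i.2.2)) ((q.1, j.1.2), (q.2, j.2.2))) =
          pairPower (Fin K) τ (i.1.2, i.2.2) (j.1.2, j.2.2) • τ := by
        ext p q
        simp [pairPower, Fin.prod_univ_succ, Fin.consEquiv, mul_comm]
      simp only [tensorId, Matrix.of_apply]
      rw [this, hΛ.isLinearMap.map_smul, Matrix.smul_apply, smul_eq_mul, mul_comm]
    rw [h1]
    ext i j
    simp only [tensorId, Matrix.submatrix_apply, Matrix.of_apply]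
    have h2 : (Matrix.of fun p q : (Fin K → X) × (Fin K → Y) =>
        Λ τ (i.1 0, i.2 0) (j.1 0, j.2 0) * pairPower (Fin K) τ p q) =
        Λ τ (i.1 0, i.2 0) (j.1 0, j.2 0) • pairPower (Fin K) τ := rfl
    have h3 := congr_fun₂ (congrArg Ξ h2) (Fin.tail i.1, Fin.tail i.2)
      (Fin.tail j.1, Fin.tail j.2)
    rw [hΞ.isLinearMap.map_smul, h, Matrix.smul_apply, smul_eq_mul] at h3
    refine Eq.trans h3 ?_
    simp [pairPower, Fin.prod_univ_succ, Fin.tail]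

/-- An LOCC protocol can be run on many copies in parallel. -/
theorem exists_isLOCC_pairPower
    {Λ : Matrix (X × Y) (X × Y) ℂ → Matrix (X' × Y') (X' × Y') ℂ} (hΛ : IsLOCC Λ)
    (ι : Type) [Fintype ι] [DecidableEq ι] :
    ∃ Ξ : Matrix ((ι → X) × (ι → Y)) ((ι → X) × (ι → Y)) ℂ →
        Matrix ((ι → X') × (ι → Y')) ((ι → X') × (ι → Y')) ℂ,
      IsLOCC Ξ ∧ ∀ τ, Ξ (pairPower ι τ) = pairPower ι (Λ τ) := by
  obtain ⟨Ξ, hΞ, h⟩ := exists_isLOCC_pairPower_fin hΛ (Fintype.card ι)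
  let e := Fintype.equivFin ι
  refine ⟨_, (IsLOCC.relabel (e.arrowCongr (Equiv.refl X')) (e.arrowCongr (Equiv.refl Y'))).comp
    (hΞ.comp (IsLOCC.relabel (e.symm.arrowCongr (Equiv.refl X))
      (e.symm.arrowCongr (Equiv.refl Y)))), fun τ => ?_⟩
  rw [pairPower_submatrix_arrowCongr, h, pairPower_submatrix_arrowCongr]

/-- Some of the copies can be discarded. -/
theorem exists_isLOCC_pairPower_of_sum {ι κ R : Type} [Fintype ι] [DecidableEq ι] [Fintype κ]
    [DecidableEq κ] [Fintype R] [DecidableEq R] (e : ι ⊕ R ≃ κ) :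
    ∃ Ξ : Matrix ((κ → X) × (κ → Y)) ((κ → X) × (κ → Y)) ℂ →
        Matrix ((ι → X) × (ι → Y)) ((ι → X) × (ι → Y)) ℂ,
      IsLOCC Ξ ∧ ∀ τ, IsDensity τ → Ξ (pairPower κ τ) = pairPower ι τ := by
  refine ⟨_, IsLOCC.discard
    ((e.symm.arrowCongr (Equiv.refl X)).trans (Equiv.sumArrowEquivProdArrow ι R X))
    ((e.symm.arrowCongr (Equiv.refl Y)).trans (Equiv.sumArrowEquivProdArrow ι R Y)),
    fun τ hτ => ?_⟩
  ext i j
  have htr := (pairPower_isDensity R hτ).2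
  simp only [Matrix.trace, Matrix.diag, Fintype.sum_prod_type] at htr
  -- The discarded copies contribute their trace, which is 1.
  rw [← mul_one (pairPower ι τ i j), ← htr, Finset.mul_sum]
  refine Finset.sum_congr rfl fun s _ => ?_
  rw [Finset.mul_sum]
  refine Finset.sum_congr rfl fun t _ => ?_
  simp only [pairPower, Matrix.of_apply]
  rw [← e.prod_comp]
  simp [Equiv.arrowCongr]

/-- The copies can be grouped into blocks. -/
theorem exists_isLOCC_pairPower_prod (ι κ : Type) [Fintype ι] [DecidableEq ι] [Fintype κ]
    [DecidableEq κ] :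
    ∃ Ξ : Matrix ((ι × κ → X) × (ι × κ → Y)) ((ι × κ → X) × (ι × κ → Y)) ℂ →
        Matrix ((ι → κ → X) × (ι → κ → Y)) ((ι → κ → X) × (ι → κ → Y)) ℂ,
      IsLOCC Ξ ∧ ∀ τ, Ξ (pairPower (ι × κ) τ) = pairPower ι (pairPower κ τ) := by
  refine ⟨_, IsLOCC.relabel (Equiv.curry ι κ X).symm (Equiv.curry ι κ Y).symm, fun τ => ?_⟩
  ext i j
  simp only [pairPower, Matrix.submatrix_apply, Matrix.of_apply, Fintype.prod_prod_type]
  rfl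

end ManyCopies

/-! ## Bell states -/

section Bell

/-- The character `(-1) ^ a`. -/
noncomputable def sgn (a : ZMod 2) : ℂ := if a = 0 then 1 else -1

theorem sgn_zero : sgn 0 = 1 := if_pos rfl

theorem sgn_eq_zero_or_one (a : ZMod 2) : a = 0 ∨ a = 1 := by revert a; decide

theorem sgn_add (a b : ZMod 2) : sgn (a + b) = sgn a * sgn b := by
  have h2 : (1 + 1 : ZMod 2) = 0 := by decide
  rcases sgn_eq_zero_or_one a with rfl | rfl <;> rcases sgn_eq_zero_or_one b with rfl | rfl <;>
    simp [sgn, h2]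

theorem sgn_mul_self (a : ZMod 2) : sgn a * sgn a = 1 := by
  unfold sgn; split_ifs <;> norm_num

theorem star_sgn (a : ZMod 2) : star (sgn a) = sgn a := by
  unfold sgn; split_ifs <;> simp

theorem sgn_sum {ι : Type*} (s : Finset ι) (f : ι → ZMod 2) :
    sgn (∑ i ∈ s, f i) = ∏ i ∈ s, sgn (f i) := by
  classical
  induction s using Finset.induction_on with
  | empty => exact sgn_zero
  | insert a s ha ih => rw [Finset.sum_insert ha, Finset.prod_insert ha, sgn_add, ih]

variable {ι : Type} [Fintype ι]

omit [Fintype ι] in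
theorem add_self_bits (v : ι → ZMod 2) : v + v = 0 := by
  funext i
  have : ∀ a : ZMod 2, a + a = 0 := by decide
  exact this (v i)

omit [Fintype ι] in
theorem add_add_self_bits (v w : ι → ZMod 2) : v + (v + w) = w := by
  rw [← add_assoc, add_self_bits, zero_add]

omit [Fintype ι] in
theorem eq_add_iff_bits (v w s : ι → ZMod 2) : v = w + s ↔ v + w = s := by
  constructor
  · rintro rfl
    rw [add_comm, add_add_self_bits]
  · rintro rfl
    rw [add_comm v, add_add_self_bits]

/-- Orthogonality of characters. It turns the measurements in the conjugate basis into equations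
between phase flips. -/
theorem sum_sgn_dotProduct [DecidableEq ι] (v : ι → ZMod 2) :
    ∑ t : ι → ZMod 2, sgn (t ⬝ᵥ v) = if v = 0 then (2 : ℂ) ^ Fintype.card ι else 0 := by
  have h := Finset.prod_univ_sum (fun _ : ι => (Finset.univ : Finset (ZMod 2)))
    fun i a => sgn (a * v i)
  rw [Fintype.piFinset_univ] at h
  simp only [dotProduct, sgn_sum]
  rw [← h]
  have h2 : ∀ b : ZMod 2, ∑ a : ZMod 2, sgn (a * b) = if b = 0 then 2 else 0 := by
    intro b
    have : (Finset.univ : Finset (ZMod 2)) = {0, 1} := by decide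
    rw [this, Finset.sum_pair (by decide)]
    rcases sgn_eq_zero_or_one b with rfl | rfl <;> simp [sgn]
    norm_num
  simp_rw [h2]
  rw [Finset.prod_ite_zero, Finset.prod_const, Finset.card_univ]
  simp [funext_iff]

/-- The maximally entangled state of `ι` pairs of qubits, with the bit flips `e.1` and the phase
flips `e.2`. -/
noncomputable def bellState (ι : Type) [Fintype ι] (e : (ι → ZMod 2) × (ι → ZMod 2)) :
    Matrix ((ι → ZMod 2) × (ι → ZMod 2)) ((ι → ZMod 2) × (ι → ZMod 2)) ℂ :=
  Matrix.of fun i j => if i.2 = i.1 + e.1 ∧ j.2 = j.1 + e.1 then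
    ((2 : ℂ) ^ Fintype.card ι)⁻¹ * sgn (e.2 ⬝ᵥ i.1) * sgn (e.2 ⬝ᵥ j.1) else 0

/-- The four Bell states of a pair of qubits. -/
noncomputable def bellPair (e : ZMod 2 × ZMod 2) :
    Matrix (ZMod 2 × ZMod 2) (ZMod 2 × ZMod 2) ℂ :=
  Matrix.of fun i j => if i.2 = i.1 + e.1 ∧ j.2 = j.1 + e.1 then
    (2 : ℂ)⁻¹ * sgn (e.2 * i.1) * sgn (e.2 * j.1) else 0

/-- Copies of a Bell diagonal state are a classical mixture over independent error strings, so a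
protocol may be analysed on one string at a time. -/
theorem pairPower_sum_bellPair [DecidableEq ι] (p : ZMod 2 × ZMod 2 → ℂ) :
    pairPower ι (∑ e, p e • bellPair e) = ∑ e : ι → ZMod 2 × ZMod 2,
      (∏ i, p (e i)) • bellState ι (fun i => (e i).1, fun i => (e i).2) := by
  ext x y
  have h := Finset.prod_univ_sum (fun _ : ι => (Finset.univ : Finset (ZMod 2 × ZMod 2)))
    fun i e => p e * bellPair e (x.1 i, x.2 i) (y.1 i, y.2 i)
  rw [Fintype.piFinset_univ] at h
  simp only [pairPower, Matrix.of_apply, Matrix.sum_apply, Matrix.smul_apply, smul_eq_mul]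
  rw [h]
  refine Finset.sum_congr rfl fun e _ => ?_
  rw [Finset.prod_mul_distrib]
  congr 1
  simp only [bellPair, bellState, Matrix.of_apply]
  rw [Finset.prod_ite_zero, Finset.prod_mul_distrib, Finset.prod_mul_distrib, dotProduct,
    dotProduct, sgn_sum, sgn_sum, Finset.prod_const, Finset.card_univ, inv_pow]
  simp [funext_iff, forall_and]

theorem bellState_eq_vecMulVec (e : (ι → ZMod 2) × (ι → ZMod 2)) :
    bellState ι e = ((2 : ℝ) ^ Fintype.card ι)⁻¹ • Matrix.vecMulVec
      (fun i => if i.2 = i.1 + e.1 then sgn (e.2 ⬝ᵥ i.1) else 0)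
      (star fun i => if i.2 = i.1 + e.1 then sgn (e.2 ⬝ᵥ i.1) else 0) := by
  ext i j
  by_cases h1 : i.2 = i.1 + e.1 <;> by_cases h2 : j.2 = j.1 + e.1 <;>
    simp [bellState, Matrix.vecMulVec_apply, h1, h2, star_sgn]
  rw [mul_assoc]

theorem bellState_posSemidef [DecidableEq ι] (e : (ι → ZMod 2) × (ι → ZMod 2)) :
    (bellState ι e).PosSemidef := by
  rw [bellState_eq_vecMulVec]
  exact posSemidef_real_smul (Matrix.posSemidef_vecMulVec_self_star _) (by positivity)

theorem bellState_trace [DecidableEq ι] (e : (ι → ZMod 2) × (ι → ZMod 2)) :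
    (bellState ι e).trace = 1 := by
  simp only [Matrix.trace, Matrix.diag, bellState, Matrix.of_apply, Fintype.sum_prod_type,
    and_self, mul_assoc, sgn_mul_self, mul_one]
  simp [ZMod.card]

theorem bellPair_posSemidef (e : ZMod 2 × ZMod 2) : (bellPair e).PosSemidef := by
  have h : bellPair e = (1 / 2 : ℝ) • Matrix.vecMulVec
      (fun i => if i.2 = i.1 + e.1 then sgn (e.2 * i.1) else 0)
      (star fun i => if i.2 = i.1 + e.1 then sgn (e.2 * i.1) else 0) := by
    ext i j
    have := star_sgn (e.2 * j.1)
    rw [Complex.star_def] at this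
    by_cases h1 : i.2 = i.1 + e.1 <;> by_cases h2 : j.2 = j.1 + e.1 <;>
      simp [bellPair, Matrix.vecMulVec_apply, h1, h2, this, mul_assoc]
  rw [h]
  exact posSemidef_real_smul (Matrix.posSemidef_vecMulVec_self_star _) (by positivity)

theorem bellPair_trace (e : ZMod 2 × ZMod 2) : (bellPair e).trace = 1 := by
  simp only [Matrix.trace, Matrix.diag, bellPair, Matrix.of_apply, Fintype.sum_prod_type,
    and_self, mul_assoc, sgn_mul_self, mul_one]
  simp [ZMod.card]

/-! ## Twirling -/

/-- Pauli operators. -/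
noncomputable def pauli (e : ZMod 2 × ZMod 2) : Matrix (ZMod 2) (ZMod 2) ℂ :=
  Matrix.of fun x y => if y = x + e.1 then sgn (e.2 * y) else 0

theorem univ_zmod_two : (Finset.univ : Finset (ZMod 2)) = {0, 1} := by decide

theorem sum_zmod_two {M : Type*} [AddCommMonoid M] (f : ZMod 2 → M) :
    ∑ a, f a = f 0 + f 1 := by
  rw [univ_zmod_two, Finset.sum_pair (by decide)]

theorem pauli_isometry (e : ZMod 2 × ZMod 2) : (pauli e)ᴴ * pauli e = 1 := by
  obtain ⟨a, b⟩ := e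
  ext i j
  rw [Matrix.mul_apply, sum_zmod_two]
  rcases sgn_eq_zero_or_one a with rfl | rfl <;> rcases sgn_eq_zero_or_one b with rfl | rfl <;>
    rcases sgn_eq_zero_or_one i with rfl | rfl <;> rcases sgn_eq_zero_or_one j with rfl | rfl <;>
    simp [pauli, sgn, show (1 + 1 : ZMod 2) = 0 by decide]

/-- Every state of a pair of qubits can be twirled to a Bell diagonal state. -/
theorem exists_isLOCC_twirl :
    ∃ T : Matrix (ZMod 2 × ZMod 2) (ZMod 2 × ZMod 2) ℂ →
        Matrix (ZMod 2 × ZMod 2) (ZMod 2 × ZMod 2) ℂ,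
      IsLOCC T ∧ ∀ ω, T ω = ∑ e, (ω * bellPair e).trace • bellPair e := by
  -- Both parties apply the same Pauli operator, drawn with probability 1/4. Bell states are common
  -- eigenvectors of these pairs with distinct sign patterns, so the coherences between them average
  -- out.
  refine ⟨_, IsLOCC.oneWay (ι := ZMod 2 × ZMod 2) (κ := Unit) (fun e => (1 / 2 : ℂ) • pauli e) ?_
    (fun e _ => pauli e) fun e => ?_, fun ω => ?_⟩
  · simp only [Matrix.conjTranspose_smul, Matrix.smul_mul, Matrix.mul_smul, pauli_isometry,
      smul_smul, Finset.sum_const, Finset.card_univ, Fintype.card_prod, ZMod.card]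
    ext i j
    simp [Matrix.smul_apply]
    ring
  · simp [pauli_isometry]
  · ext ⟨x, y⟩ ⟨x', y'⟩
    have h2 : (1 + 1 : ZMod 2) = 0 := by decide
    simp only [Matrix.sum_apply, Fintype.sum_prod_type, sum_zmod_two,
      Finset.univ_unique, Finset.sum_singleton, Matrix.smul_apply, smul_eq_mul, Matrix.trace,
      Matrix.diag, Matrix.mul_apply]
    rcases sgn_eq_zero_or_one x with rfl | rfl <;> rcases sgn_eq_zero_or_one y with rfl | rfl <;>
    rcases sgn_eq_zero_or_one x' with rfl | rfl <;> rcases sgn_eq_zero_or_one y' with rfl | rfl <;>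
    simp [pauli, bellPair, sgn, h2] <;> ring

end Bell

/-! ## The hashing protocol -/

section Hashing

/-- The amplitudes of a maximally entangled state of three blocks with bit flips `u` and phase flips
`w`. -/
noncomputable def blockAmplitude {m : ℕ}
    (u w : (Fin m → ZMod 2) × (Fin m → ZMod 2) × (Fin m → ZMod 2)) :
    ((Fin m → ZMod 2) × (Fin m → ZMod 2) × (Fin m → ZMod 2)) ×
      ((Fin m → ZMod 2) × (Fin m → ZMod 2) × (Fin m → ZMod 2)) → ℂ :=
  fun i => if i.2 = i.1 + u then
    sgn (w.1 ⬝ᵥ i.1.1) * sgn (w.2.1 ⬝ᵥ i.1.2.1) * sgn (w.2.2 ⬝ᵥ i.1.2.2) else 0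

/-- The Kraus operator of a measurement of the first block in the computational basis and of the
second block in the conjugate basis, followed by a correction of the third block. -/
noncomputable def hashKraus {m : ℕ} (α β : (Fin m → ZMod 2) → (Fin m → ZMod 2))
    (σ : (Fin m → ZMod 2) × (Fin m → ZMod 2)) :
    Matrix (Fin m → ZMod 2) ((Fin m → ZMod 2) × (Fin m → ZMod 2) × (Fin m → ZMod 2)) ℂ :=
  Matrix.of fun y x => if x.1 = σ.1 ∧ x.2.2 = y + α σ.1 then
    ((√(2 ^ m) : ℝ) : ℂ)⁻¹ * sgn (σ.2 ⬝ᵥ x.2.1) * sgn (β σ.2 ⬝ᵥ y) else 0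

theorem sqrt_two_pow_inv_mul_self (m : ℕ) :
    (((√(2 ^ m) : ℝ) : ℂ)⁻¹) * (((√(2 ^ m) : ℝ) : ℂ)⁻¹) = ((2 : ℂ) ^ m)⁻¹ := by
  rw [← mul_inv, ← Complex.ofReal_mul, Real.mul_self_sqrt (by positivity)]
  push_cast
  rfl

theorem sum_hashKraus {m : ℕ} (α β : (Fin m → ZMod 2) → (Fin m → ZMod 2)) :
    ∑ σ, (hashKraus α β σ)ᴴ * hashKraus α β σ = 1 := by
  ext a b
  simp only [Matrix.sum_apply, Matrix.mul_apply, Matrix.conjTranspose_apply, Fintype.sum_prod_type]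
  -- The correction signs cancel, and t enters only through a character of the difference of the
  -- second blocks; the sum over t forces these blocks to agree.
  have hterm : ∀ s t y : Fin m → ZMod 2,
      star (hashKraus α β (s, t) y a) * hashKraus α β (s, t) y b =
      if s = a.1 ∧ y = a.2.2 + α a.1 then
        (if b.1 = a.1 ∧ b.2.2 = a.2.2 then ((2 : ℂ) ^ m)⁻¹ * sgn (t ⬝ᵥ (a.2.1 + b.2.1)) else 0)
      else 0 := by
    intro s t y
    simp only [hashKraus, Matrix.of_apply]
    by_cases h1 : s = a.1
    · subst h1
      by_cases h2 : y = a.2.2 + α a.1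
      · subst h2
        have e1 : a.2.2 + α a.1 + α a.1 = a.2.2 := by
          rw [add_assoc, add_self_bits, add_zero]
        simp only [e1, and_self, if_true]
        by_cases h3 : b.1 = a.1 ∧ b.2.2 = a.2.2
        · rw [if_pos h3, if_pos h3, star_mul', star_mul', star_sgn, star_sgn,
            dotProduct_add t, sgn_add (t ⬝ᵥ a.2.1), ← sqrt_two_pow_inv_mul_self]
          have : star (((√(2 ^ m) : ℝ) : ℂ)⁻¹) = ((√(2 ^ m) : ℝ) : ℂ)⁻¹ := by
            rw [Complex.star_def, ← Complex.ofReal_inv, Complex.conj_ofReal]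
          rw [this]
          linear_combination (((√(2 ^ m) : ℝ) : ℂ)⁻¹ * ((√(2 ^ m) : ℝ) : ℂ)⁻¹ *
            sgn (t ⬝ᵥ a.2.1) * sgn (t ⬝ᵥ b.2.1)) * sgn_mul_self (β t ⬝ᵥ (a.2.2 + α a.1))
        · rw [if_neg h3, if_neg h3, mul_zero]
      · have h3 : ¬ (a.2.2 = y + α a.1) := fun h => h2 (by
          rw [h, add_assoc, add_self_bits, add_zero])
        simp [h2, h3]
    · have h3 : ¬ (a.1 = s) := fun h => h1 h.symm
      simp [h1, h3]
  simp only [hterm]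
  have hsum : ∀ f : (Fin m → ZMod 2) → ℂ, ∀ s0 y0 : Fin m → ZMod 2,
      ∑ s, ∑ t, ∑ y, (if s = s0 ∧ y = y0 then f t else 0) = ∑ t, f t := by
    intro f s0 y0
    simp only [ite_and]
    simp
  rw [hsum]
  by_cases h : b.1 = a.1 ∧ b.2.2 = a.2.2
  · simp only [if_pos h]
    rw [← Finset.mul_sum, sum_sgn_dotProduct]
    simp only [← eq_add_iff_bits, Matrix.one_apply, Prod.ext_iff, h.1, h.2, Fintype.card_fin, add_zero]
    by_cases h' : a.2.1 = b.2.1 <;> simp [h']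
  · simp only [if_neg h, Finset.sum_const_zero]
    rw [Matrix.one_apply_ne]
    rintro rfl
    exact h ⟨rfl, rfl⟩

theorem kronecker_conj_vecMulVec {X Y X' Y' : Type} [Fintype X] [Fintype Y] (K : Matrix X' X ℂ)
    (L : Matrix Y' Y ℂ) (r : ℝ) (ψ : X × Y → ℂ) :
    (K ⊗ₖ L) * (r • Matrix.vecMulVec ψ (star ψ)) * (K ⊗ₖ L)ᴴ =
      r • Matrix.vecMulVec ((K ⊗ₖ L) *ᵥ ψ) (star ((K ⊗ₖ L) *ᵥ ψ)) := by
  rw [Matrix.mul_smul, Matrix.smul_mul, Matrix.mul_vecMulVec, Matrix.vecMulVec_mul,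
    Matrix.star_mulVec]

/-- The sum of the two parties' outcomes is forced to be the syndrome (u.1, w.2.1). If the decoders
are right on it, the third block is left without errors; the remaining components u.2.1 and w.1
enter only as a global sign. -/
theorem hashKraus_mulVec {m : ℕ} (α β : (Fin m → ZMod 2) → (Fin m → ZMod 2))
    {u w : (Fin m → ZMod 2) × (Fin m → ZMod 2) × (Fin m → ZMod 2)}
    (hu : α u.1 = u.2.2) (hw : β w.2.1 = w.2.2) (σ τ : (Fin m → ZMod 2) × (Fin m → ZMod 2))
    (i : (Fin m → ZMod 2) × (Fin m → ZMod 2)) :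
    ((hashKraus (fun _ => 0) (fun _ => 0) σ ⊗ₖ
      hashKraus (fun s => α (σ.1 + s)) (fun t => β (σ.2 + t)) τ) *ᵥ blockAmplitude u w) i =
    if τ = (σ.1 + u.1, σ.2 + w.2.1) then
      (if i.1 = i.2 then sgn (τ.2 ⬝ᵥ u.2.1) * sgn (w.1 ⬝ᵥ σ.1) else 0) else 0 := by
  obtain ⟨y, z⟩ := i
  obtain ⟨s, t⟩ := σ
  obtain ⟨s', t'⟩ := τ
  obtain ⟨u1, u2, u3⟩ := u
  obtain ⟨w1, w2, w3⟩ := w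
  simp only at hu hw
  set c : ℂ := ((√(2 ^ m) : ℝ) : ℂ)⁻¹ with hc
  have hcc : c * c = ((2 : ℂ) ^ m)⁻¹ := sqrt_two_pow_inv_mul_self m
  have step : ((hashKraus (fun _ => 0) (fun _ => 0) (s, t) ⊗ₖ
      hashKraus (fun a => α (s + a)) (fun b => β (t + b)) (s', t')) *ᵥ
        blockAmplitude (u1, u2, u3) (w1, w2, w3)) (y, z) =
      ∑ b, c * sgn (t ⬝ᵥ b) * (if s + u1 = s' ∧ y + u3 = z + α (s + s') then
        c * sgn (t' ⬝ᵥ (b + u2)) * sgn (β (t + t') ⬝ᵥ z) else 0) *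
        (sgn (w1 ⬝ᵥ s) * sgn (w2 ⬝ᵥ b) * sgn (w3 ⬝ᵥ y)) := by
    change ∑ q, (hashKraus _ _ _ ⊗ₖ hashKraus _ _ _) (y, z) q * blockAmplitude _ _ q = _
    simp only [Matrix.kroneckerMap_apply]
    rw [Fintype.sum_prod_type]
    simp only [blockAmplitude, mul_ite, mul_zero, Finset.sum_ite_eq', Finset.mem_univ,
      if_true]
    rw [Fintype.sum_prod_type, Finset.sum_eq_single s]
    · rw [Fintype.sum_prod_type]
      refine Finset.sum_congr rfl fun b _ => ?_
      rw [Finset.sum_eq_single y]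
      · simp [hashKraus, hc, sgn_zero]
      · intro y' _ hy
        simp [hashKraus, hy]
      · simp
    · intro a _ ha
      refine Finset.sum_eq_zero fun b _ => ?_
      simp [hashKraus, ha]
    · simp
  rw [step]
  by_cases h1 : s' = s + u1
  · subst h1
    rw [add_add_self_bits, hu]
    by_cases h2 : y = z
    · subst h2
      simp only [and_self, if_true, Prod.mk.injEq, true_and]
      have hsum : ∀ b, c * sgn (t ⬝ᵥ b) * (c * sgn (t' ⬝ᵥ (b + u2)) * sgn (β (t + t') ⬝ᵥ y)) *
          (sgn (w1 ⬝ᵥ s) * sgn (w2 ⬝ᵥ b) * sgn (w3 ⬝ᵥ y)) =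
          (((2 : ℂ) ^ m)⁻¹ * sgn (t' ⬝ᵥ u2) * sgn (β (t + t') ⬝ᵥ y) * sgn (w1 ⬝ᵥ s) *
            sgn (w3 ⬝ᵥ y)) * sgn (b ⬝ᵥ (t' + (t + w2))) := by
        intro b
        rw [dotProduct_comm b, add_dotProduct, add_dotProduct, sgn_add, sgn_add, dotProduct_add,
          sgn_add, ← hcc]
        ring
      simp only [hsum]
      rw [← Finset.mul_sum, sum_sgn_dotProduct]
      simp only [← eq_add_iff_bits, add_zero, Fintype.card_fin]
      by_cases h3 : t' = t + w2
      · subst h3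
        simp only [if_true]
        rw [add_add_self_bits, hw]
        have h0 : (2 : ℂ) ^ m ≠ 0 := by positivity
        have := sgn_mul_self (w3 ⬝ᵥ y)
        field_simp
        linear_combination (sgn (w1 ⬝ᵥ s) * sgn ((t + w2) ⬝ᵥ u2)) * this
      · simp [h3]
    · simp [h2]
  · have h1' : ¬ (s + u1 = s') := fun h => h1 h.symm
    simp [h1, h1']

/-- The one-way hashing protocol with decoders `α` for the bit flips and `β` for the phase flips. -/
theorem exists_isLOCC_hash_block {m : ℕ} (α β : (Fin m → ZMod 2) → (Fin m → ZMod 2)) :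
    ∃ H : Matrix (((Fin m → ZMod 2) × (Fin m → ZMod 2) × (Fin m → ZMod 2)) ×
          ((Fin m → ZMod 2) × (Fin m → ZMod 2) × (Fin m → ZMod 2)))
        (((Fin m → ZMod 2) × (Fin m → ZMod 2) × (Fin m → ZMod 2)) ×
          ((Fin m → ZMod 2) × (Fin m → ZMod 2) × (Fin m → ZMod 2))) ℂ →
        Matrix ((Fin m → ZMod 2) × (Fin m → ZMod 2)) ((Fin m → ZMod 2) × (Fin m → ZMod 2)) ℂ,
      IsLOCC H ∧ ∀ u w, α u.1 = u.2.2 → β w.2.1 = w.2.2 →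
        H (((2 : ℝ) ^ (m + (m + m)))⁻¹ • Matrix.vecMulVec (blockAmplitude u w)
          (star (blockAmplitude u w))) = maxEntangled (Fin m → ZMod 2) := by
  refine ⟨_, IsLOCC.oneWay (hashKraus (fun _ => 0) (fun _ => 0)) (sum_hashKraus _ _)
    (fun σ => hashKraus (fun s => α (σ.1 + s)) (fun t => β (σ.2 + t)))
    (fun σ => sum_hashKraus _ _), fun u w hu hw => ?_⟩
  ext i j
  simp only [kronecker_conj_vecMulVec, Matrix.sum_apply, Matrix.smul_apply,
    Matrix.vecMulVec_apply, Pi.star_apply, hashKraus_mulVec α β hu hw, apply_ite star, star_zero,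
    star_mul', star_sgn, Complex.real_smul]
  have hterm : ∀ σ τ : (Fin m → ZMod 2) × (Fin m → ZMod 2),
      ((((2 : ℝ) ^ (m + (m + m)))⁻¹ : ℝ) : ℂ) *
        ((if τ = (σ.1 + u.1, σ.2 + w.2.1) then
          (if i.1 = i.2 then sgn (τ.2 ⬝ᵥ u.2.1) * sgn (w.1 ⬝ᵥ σ.1) else 0) else 0) *
        (if τ = (σ.1 + u.1, σ.2 + w.2.1) then
          (if j.1 = j.2 then sgn (τ.2 ⬝ᵥ u.2.1) * sgn (w.1 ⬝ᵥ σ.1) else 0) else 0)) =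
      if τ = (σ.1 + u.1, σ.2 + w.2.1) then
        (if i.1 = i.2 ∧ j.1 = j.2 then ((2 : ℂ) ^ (m + (m + m)))⁻¹ else 0) else 0 := by
    intro σ τ
    have h1 := sgn_mul_self (τ.2 ⬝ᵥ u.2.1)
    have h2 := sgn_mul_self (w.1 ⬝ᵥ σ.1)
    have h3 : sgn (τ.2 ⬝ᵥ u.2.1) * sgn (w.1 ⬝ᵥ σ.1) * (sgn (τ.2 ⬝ᵥ u.2.1) * sgn (w.1 ⬝ᵥ σ.1)) =
        1 := by rw [mul_mul_mul_comm, h1, h2, one_mul]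
    by_cases e1 : τ = (σ.1 + u.1, σ.2 + w.2.1)
    · simp only [if_pos e1]
      by_cases e2 : i.1 = i.2 <;> by_cases e3 : j.1 = j.2 <;> simp [e2, e3, h3]
    · simp [e1]
  -- Each of the first party's 2^(2m) outcomes has one matching outcome of the second and
  -- contributes 2^(-3m), which gives the entry 2^(-m).
  simp only [hterm, Finset.sum_ite_eq', Finset.mem_univ, if_true, Finset.sum_const,
    Finset.card_univ, maxEntangled, Matrix.of_apply, Fintype.card_prod, Fintype.card_fun,
    Fintype.card_fin, ZMod.card]
  split_ifs
  · have h0 : (2 : ℂ) ^ m ≠ 0 := by positivity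
    rw [nsmul_eq_mul]
    push_cast
    rw [pow_add, pow_add]
    field_simp
  · simp

/-- Hashing after a linear change of coordinates `e`, which acts as `h` on the phase flips. -/
theorem exists_isLOCC_hash {m : ℕ} {J : Type} [Fintype J] [DecidableEq J]
    (hJ : Fintype.card J = m + (m + m))
    (e : (J → ZMod 2) ≃ (Fin m → ZMod 2) × (Fin m → ZMod 2) × (Fin m → ZMod 2))
    (h : (J → ZMod 2) → (Fin m → ZMod 2) × (Fin m → ZMod 2) × (Fin m → ZMod 2))
    (hadd : ∀ x u, e (x + u) = e x + e u)
    (hdot : ∀ w x, w ⬝ᵥ x = (h w).1 ⬝ᵥ (e x).1 + (h w).2.1 ⬝ᵥ (e x).2.1 +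
      (h w).2.2 ⬝ᵥ (e x).2.2)
    (α β : (Fin m → ZMod 2) → (Fin m → ZMod 2)) :
    ∃ H : Matrix ((J → ZMod 2) × (J → ZMod 2)) ((J → ZMod 2) × (J → ZMod 2)) ℂ →
        Matrix ((Fin m → ZMod 2) × (Fin m → ZMod 2)) ((Fin m → ZMod 2) × (Fin m → ZMod 2)) ℂ,
      IsLOCC H ∧ ∀ q : (J → ZMod 2) × (J → ZMod 2), α (e q.1).1 = (e q.1).2.2 →
        β (h q.2).2.1 = (h q.2).2.2 → H (bellState J q) = maxEntangled (Fin m → ZMod 2) := by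
  obtain ⟨H, hH, hH'⟩ := exists_isLOCC_hash_block α β
  refine ⟨_, hH.comp (IsLOCC.relabel e.symm e.symm), fun q hu hw => ?_⟩
  rw [← hH' _ _ hu hw, bellState_eq_vecMulVec, hJ]
  congr 1
  -- Relabelling both basis states by e moves bit flips by e; phase flips are characters, hence move
  -- by the dual map h.
  have key : ∀ i, (if (e.symm i.2) = (e.symm i.1) + q.1 then sgn (q.2 ⬝ᵥ (e.symm i.1)) else 0) =
      blockAmplitude (e q.1) (h q.2) i := by
    intro i
    rw [blockAmplitude]
    have h1 : (e.symm i.2 = e.symm i.1 + q.1) ↔ i.2 = i.1 + e q.1 := by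
      rw [Equiv.symm_apply_eq, hadd, Equiv.apply_symm_apply]
    rw [hdot, Equiv.apply_symm_apply, sgn_add, sgn_add]
    simp only [h1]
  ext i j
  simp only [Matrix.submatrix_apply, Matrix.smul_apply, Matrix.vecMulVec_apply, Pi.star_apply,
    Prod.map_fst, Prod.map_snd, key]

end Hashing

/-! ## Random linear codes -/

section Codes

/-- Maximum likelihood decoding from the syndrome `π u` can fail. -/
def DecodingFails {V S : Type} (q : V → ℝ) (π : V → S) (u : V) : Prop :=
  ∃ u', u' ≠ u ∧ π u' = π u ∧ q u ≤ q u'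

theorem exists_decoder {V S R : Type} [Fintype V] [Nonempty R] (q : V → ℝ) (π : V → S)
    (r : V → R) : ∃ α : S → R, ∀ u, ¬ DecodingFails q π u → α (π u) = r u := by
  classical
  have h : ∀ s, ∃ x : R, ∀ u, π u = s → ¬ DecodingFails q π u → x = r u := by
    intro s
    rcases (Finset.univ.filter fun u => π u = s).eq_empty_or_nonempty with h | h
    · refine ⟨Classical.arbitrary R, fun u hu => ?_⟩
      have : u ∈ Finset.univ.filter fun u => π u = s := by simpa using hu
      rw [h] at this
      exact absurd this (Finset.notMem_empty u)
    · obtain ⟨v, hv, hmax⟩ := Finset.exists_max_image _ q h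
      refine ⟨r v, fun u hu hf => ?_⟩
      by_contra hne
      refine hf ⟨v, fun e => hne (by rw [e]), ?_, hmax u (by simpa using hu)⟩
      rw [hu]
      simpa using hv
  choose α hα using h
  exact ⟨α, fun u hu => hα _ u rfl hu⟩

open Classical in
theorem sum_decodingFails_le {V S A : Type} [Fintype V] [Fintype A] (q : V → ℝ)
    (hq : ∀ u, 0 ≤ q u) (π : A → V → S) (N : ℝ) (hN : 0 ≤ N)
    (hcount : ∀ u u', u' ≠ u → ((Finset.univ.filter fun a => π a u' = π a u).card : ℝ) ≤ N) :
    ∑ a, ∑ u, (if DecodingFails q (π a) u then q u else 0) ≤ N * (∑ u, √(q u)) ^ 2 := by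
  -- Bhattacharyya bound: a competitor u' with q u ≤ q u' satisfies q u ≤ √(q u) √(q u').
  have h1 : ∀ a u, (if DecodingFails q (π a) u then q u else 0) ≤
      ∑ u', if u' ≠ u ∧ π a u' = π a u then √(q u) * √(q u') else 0 := by
    intro a u
    have hnn : ∀ u' ∈ Finset.univ, 0 ≤
        if u' ≠ u ∧ π a u' = π a u then √(q u) * √(q u') else 0 := fun u' _ => by
      split_ifs <;> positivity
    split_ifs with h
    · obtain ⟨u', h1, h2, h3⟩ := h
      refine le_trans ?_ (Finset.single_le_sum hnn (Finset.mem_univ u'))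
      rw [if_pos ⟨h1, h2⟩]
      calc q u = √(q u) * √(q u) := (Real.mul_self_sqrt (hq u)).symm
        _ ≤ _ := mul_le_mul_of_nonneg_left (Real.sqrt_le_sqrt h3) (Real.sqrt_nonneg _)
    · exact Finset.sum_nonneg hnn
  calc _ ≤ ∑ a, ∑ u, ∑ u', if u' ≠ u ∧ π a u' = π a u then √(q u) * √(q u') else 0 :=
        Finset.sum_le_sum fun a _ => Finset.sum_le_sum fun u _ => h1 a u
    _ = ∑ u, ∑ u', ∑ a, if u' ≠ u ∧ π a u' = π a u then √(q u) * √(q u') else 0 := by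
        rw [Finset.sum_comm]
        exact Finset.sum_congr rfl fun u _ => Finset.sum_comm
    _ ≤ ∑ u, ∑ u', N * (√(q u) * √(q u')) := by
        refine Finset.sum_le_sum fun u _ => Finset.sum_le_sum fun u' _ => ?_
        by_cases h : u' = u
        · simp only [h, ne_eq, not_true_eq_false, false_and, if_false, Finset.sum_const_zero]
          positivity
        · simp only [ne_eq, h, not_false_eq_true, true_and]
          rw [← Finset.sum_filter, Finset.sum_const, nsmul_eq_mul]
          exact mul_le_mul_of_nonneg_right (hcount u u' h) (by positivity)
    _ = _ := by
        rw [sq, Finset.sum_mul_sum, Finset.mul_sum]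
        exact Finset.sum_congr rfl fun u _ => by rw [Finset.mul_sum]

theorem mulVec_leftMulMatrix_eq_zero {K J : Type} [Field K] [Algebra (ZMod 2) K] [Fintype J]
    [DecidableEq J] (b : Module.Basis J (ZMod 2) K) {c : K} (hc : c ≠ 0) {v : J → ZMod 2} :
    (Algebra.leftMulMatrix b c *ᵥ v = 0 → v = 0) ∧
      ((Algebra.leftMulMatrix b c)ᵀ *ᵥ v = 0 → v = 0) := by
  have h : Algebra.leftMulMatrix b c⁻¹ * Algebra.leftMulMatrix b c = 1 := by
    rw [← map_mul, inv_mul_cancel₀ hc, map_one]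
  have h' : Algebra.leftMulMatrix b c * Algebra.leftMulMatrix b c⁻¹ = 1 := by
    rw [← map_mul, mul_inv_cancel₀ hc, map_one]
  constructor
  · intro h0
    rw [← Matrix.one_mulVec v, ← h, ← Matrix.mulVec_mulVec, h0, Matrix.mulVec_zero]
  · intro h0
    rw [← Matrix.one_mulVec v, ← Matrix.transpose_one, ← h', Matrix.transpose_mul,
      ← Matrix.mulVec_mulVec, h0, Matrix.mulVec_zero]

/-- A family of invertible matrices such that the matrices and their inverse transposes map every
nonzero vector injectively to nonzero vectors. -/
theorem exists_matrix_family {J : Type} [Fintype J] [DecidableEq J] [Nonempty J] :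
    ∃ (A : Type) (_ : Fintype A) (M N : A → Matrix J J (ZMod 2)),
      Fintype.card A = 2 ^ Fintype.card J - 1 ∧ (∀ a, (N a)ᵀ * M a = 1) ∧
      (∀ v, v ≠ 0 → (Function.Injective fun a => M a *ᵥ v) ∧ ∀ a, M a *ᵥ v ≠ 0) ∧
      (∀ v, v ≠ 0 → (Function.Injective fun a => N a *ᵥ v) ∧ ∀ a, N a *ᵥ v ≠ 0) := by
  classical
  have : Fact (Nat.Prime 2) := ⟨Nat.prime_two⟩
  have hn : Fintype.card J ≠ 0 := Fintype.card_ne_zero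
  -- The matrices are multiplications by the units of this field. A difference of distinct field
  -- elements is invertible, and this passes to inverses and transposes.
  let K := GaloisField 2 (Fintype.card J)
  let _ : Fintype K := Fintype.ofFinite K
  let b : Module.Basis J (ZMod 2) K := (Module.finBasisOfFinrankEq (ZMod 2) K
    (GaloisField.finrank 2 hn)).reindex (Fintype.equivFin J).symm
  refine ⟨Kˣ, inferInstance, fun a => Algebra.leftMulMatrix b (a : K),
    fun a => (Algebra.leftMulMatrix b (a : K)⁻¹)ᵀ, ?_, fun a => ?_, fun v hv => ⟨?_, ?_⟩,
    fun v hv => ⟨?_, ?_⟩⟩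
  · rw [Fintype.card_units, ← Nat.card_eq_fintype_card, GaloisField.card 2 _ hn]
  · rw [Matrix.transpose_transpose, ← map_mul, inv_mul_cancel₀ a.ne_zero, map_one]
  · intro a a' h
    by_contra hne
    have hne' : (a : K) - a' ≠ 0 := sub_ne_zero.mpr fun e => hne (Units.ext e)
    refine hv ((mulVec_leftMulMatrix_eq_zero b hne').1 ?_)
    rw [map_sub, Matrix.sub_mulVec, sub_eq_zero]
    exact h
  · exact fun a h => hv ((mulVec_leftMulMatrix_eq_zero b a.ne_zero).1 h)
  · intro a a' h
    by_contra hne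
    have hne' : (a : K)⁻¹ - (a' : K)⁻¹ ≠ 0 :=
      sub_ne_zero.mpr fun e => hne (Units.ext (inv_injective e))
    refine hv ((mulVec_leftMulMatrix_eq_zero b hne').2 ?_)
    rw [map_sub, Matrix.transpose_sub, Matrix.sub_mulVec, sub_eq_zero]
    exact h
  · exact fun a h => hv ((mulVec_leftMulMatrix_eq_zero b (inv_ne_zero a.ne_zero)).2 h)

open Classical in
/-- The number of matrices of such a family for which two vectors have the same syndrome. -/
theorem card_same_syndrome_le {A J W X : Type} [Fintype A] [Fintype J] [DecidableEq J] [Fintype W]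
    [Fintype X] [AddCommGroup W] [AddCommGroup X]
    (M : A → Matrix J J (ZMod 2))
    (hM : ∀ v, v ≠ 0 → (Function.Injective fun a => M a *ᵥ v) ∧ ∀ a, M a *ᵥ v ≠ 0)
    (s : (J → ZMod 2) ≃+ W × X) {u u' : J → ZMod 2} (h : u' ≠ u) :
    (Finset.univ.filter fun a => (s (M a *ᵥ u')).1 = (s (M a *ᵥ u)).1).card ≤
      Fintype.card X - 1 := by
  -- When the syndromes agree, the image of u' - u is determined by its second component, which in
  -- turn determines a. This component is never zero; hence the -1.
  obtain ⟨hinj, hne⟩ := hM (u' - u) (sub_ne_zero.mpr h)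
  rw [← Finset.card_univ, ← Finset.card_erase_of_mem (Finset.mem_univ (0 : X))]
  have hsub : ∀ a, (s (M a *ᵥ u')).1 = (s (M a *ᵥ u)).1 → (s (M a *ᵥ (u' - u))).1 = 0 := by
    intro a ha
    rw [Matrix.mulVec_sub, map_sub, Prod.fst_sub, ha, sub_self]
  refine Finset.card_le_card_of_injOn (fun a => (s (M a *ᵥ (u' - u))).2) ?_ ?_
  · intro a ha
    have ha' := hsub a (by simpa using ha)
    simp only [Finset.coe_erase, Finset.coe_univ, Set.mem_sdiff, Set.mem_univ, true_and,
      Set.mem_singleton_iff]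
    intro h0
    exact hne a (s.map_eq_zero_iff.mp (Prod.ext ha' h0))
  · intro a ha a' ha' haa
    have h1 := hsub a (by simpa using ha)
    have h2 := hsub a' (by simpa using ha')
    exact hinj (s.injective (Prod.ext (h1.trans h2.symm) haa))

end Codes

/-! ## Distillation of Bell diagonal states -/

section Distillation

/-- The positions in three blocks of length `m`. -/
abbrev Blocks (m : ℕ) : Type := Fin m ⊕ (Fin m ⊕ Fin m)

/-- Three blocks of `m` bits. -/
def blockSplit (m : ℕ) : (Blocks m → ZMod 2) ≃+
    (Fin m → ZMod 2) × (Fin m → ZMod 2) × (Fin m → ZMod 2) where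
  toFun x := (fun i => x (.inl i), fun i => x (.inr (.inl i)), fun i => x (.inr (.inr i)))
  invFun y := Sum.elim y.1 (Sum.elim y.2.1 y.2.2)
  left_inv x := by ext (i | i | i) <;> rfl
  right_inv y := rfl
  map_add' x y := rfl

/-- Three blocks of `m` bits, the second one first. -/
def blockSplit' (m : ℕ) : (Blocks m → ZMod 2) ≃+
    (Fin m → ZMod 2) × (Fin m → ZMod 2) × (Fin m → ZMod 2) where
  toFun x := (fun i => x (.inr (.inl i)), fun i => x (.inl i), fun i => x (.inr (.inr i)))
  invFun y := Sum.elim y.2.1 (Sum.elim y.1 y.2.2)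
  left_inv x := by ext (i | i | i) <;> rfl
  right_inv y := rfl
  map_add' x y := rfl

theorem dotProduct_blockSplit {m : ℕ} (w x : Blocks m → ZMod 2) :
    w ⬝ᵥ x = (blockSplit m w).1 ⬝ᵥ (blockSplit m x).1 +
      (blockSplit m w).2.1 ⬝ᵥ (blockSplit m x).2.1 +
      (blockSplit m w).2.2 ⬝ᵥ (blockSplit m x).2.2 := by
  simp only [dotProduct, Fintype.sum_sum_type, ← add_assoc]
  rfl

open Classical in
/-- A good hashing protocol for given distributions `q₁` of the bit flips and `q₂` of the phase
flips. -/
theorem exists_isLOCC_hash_code {m : ℕ} (hm : 0 < m)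
    (q₁ q₂ : (Blocks m → ZMod 2) → ℝ) (h₁ : ∀ u, 0 ≤ q₁ u) (h₂ : ∀ u, 0 ≤ q₂ u) :
    ∃ (H : Matrix ((Blocks m → ZMod 2) × (Blocks m → ZMod 2))
          ((Blocks m → ZMod 2) × (Blocks m → ZMod 2)) ℂ →
        Matrix ((Fin m → ZMod 2) × (Fin m → ZMod 2)) ((Fin m → ZMod 2) × (Fin m → ZMod 2)) ℂ)
      (F₁ F₂ : Set (Blocks m → ZMod 2)), IsLOCC H ∧
      (∀ q, q.1 ∉ F₁ → q.2 ∉ F₂ → H (bellState _ q) = maxEntangled (Fin m → ZMod 2)) ∧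
      (∑ u, if u ∈ F₁ then q₁ u else 0) + (∑ u, if u ∈ F₂ then q₂ u else 0) ≤
        ((∑ u, √(q₁ u)) ^ 2 + (∑ u, √(q₂ u)) ^ 2) / 2 ^ m := by
  have : Nonempty (Fin m) := ⟨⟨0, hm⟩⟩
  have hcard : Fintype.card (Blocks m) = m + (m + m) := by simp
  obtain ⟨A, _, M, N, hA, hNM, hM, hN⟩ := exists_matrix_family (J := Blocks m)
  set π₁ : A → (Blocks m → ZMod 2) → (Fin m → ZMod 2) := fun a u => (blockSplit m (M a *ᵥ u)).1 with hπ₁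
  -- The first block is spent on the bit flips, so the phase syndrome is taken from the second, in
  -- the dual coordinates N.
  set π₂ : A → (Blocks m → ZMod 2) → (Fin m → ZMod 2) := fun a u => (blockSplit' m (N a *ᵥ u)).1 with hπ₂
  set K : ℝ := ((2 ^ (m + m) - 1 : ℕ) : ℝ) with hK
  have hX : Fintype.card ((Fin m → ZMod 2) × (Fin m → ZMod 2)) = 2 ^ (m + m) := by
    simp [ZMod.card, pow_add]
  have e₁ := sum_decodingFails_le q₁ h₁ π₁ K (Nat.cast_nonneg _) fun u u' h => by
    have := card_same_syndrome_le M hM (blockSplit m) h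
    rw [hX] at this
    exact Nat.cast_le.mpr this
  have e₂ := sum_decodingFails_le q₂ h₂ π₂ K (Nat.cast_nonneg _) fun u u' h => by
    have := card_same_syndrome_le N hN (blockSplit' m) h
    rw [hX] at this
    exact Nat.cast_le.mpr this
  have hpos : 0 < Fintype.card A := by
    rw [hA, hcard]
    have := Nat.one_lt_two_pow (n := m + (m + m)) (by omega)
    omega
  have : Nonempty A := Fintype.card_pos_iff.mp hpos
  -- At most a fraction 2^(-m) of the codes confuses two given error strings.
  have hKA : K * 2 ^ m ≤ Fintype.card A := by
    have : (2 ^ (m + m) - 1) * 2 ^ m ≤ 2 ^ (m + (m + m)) - 1 := by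
      rw [Nat.sub_mul, one_mul, ← pow_add, show m + m + m = m + (m + m) by omega]
      have := Nat.one_le_two_pow (n := m)
      omega
    rw [hA, hcard, hK]
    exact_mod_cast this
  set R := (∑ u, √(q₁ u)) ^ 2 + (∑ u, √(q₂ u)) ^ 2 with hR
  have hR0 : 0 ≤ R := by positivity
  -- One code has to serve for both kinds of errors, so the sum of the two failure weights is
  -- averaged over the codes.
  obtain ⟨a, -, ha⟩ : ∃ a ∈ (Finset.univ : Finset A),
      (∑ u, if DecodingFails q₁ (π₁ a) u then q₁ u else 0) +
        (∑ u, if DecodingFails q₂ (π₂ a) u then q₂ u else 0) ≤ R / 2 ^ m := by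
    refine Finset.exists_le_of_sum_le Finset.univ_nonempty ?_
    rw [Finset.sum_add_distrib, Finset.sum_const, Finset.card_univ, nsmul_eq_mul]
    calc _ ≤ K * R := by rw [hR, mul_add]; exact add_le_add e₁ e₂
      _ = K * 2 ^ m * (R / 2 ^ m) := by field_simp
      _ ≤ _ := mul_le_mul_of_nonneg_right hKA (by positivity)
  have hMN : M a * (N a)ᵀ = 1 := mul_eq_one_comm.mp (hNM a)
  let g : (Blocks m → ZMod 2) ≃ (Blocks m → ZMod 2) :=
    { toFun := fun x => M a *ᵥ x
      invFun := fun x => (N a)ᵀ *ᵥ x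
      left_inv := fun x => by simp only [Matrix.mulVec_mulVec, hNM, Matrix.one_mulVec]
      right_inv := fun x => by simp only [Matrix.mulVec_mulVec, hMN, Matrix.one_mulVec] }
  obtain ⟨α, hα⟩ := exists_decoder q₁ (π₁ a) fun u => (blockSplit m (M a *ᵥ u)).2.2
  obtain ⟨β, hβ⟩ := exists_decoder q₂ (π₂ a) fun u => (blockSplit m (N a *ᵥ u)).2.2
  obtain ⟨H, hH, hH'⟩ := exists_isLOCC_hash hcard (g.trans (blockSplit m).toEquiv)
    (fun w => blockSplit m (N a *ᵥ w))
    (fun x u => by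
      change blockSplit m (M a *ᵥ (x + u)) = blockSplit m (M a *ᵥ x) + blockSplit m (M a *ᵥ u)
      rw [Matrix.mulVec_add, map_add])
    (fun w x => by
      change _ = (blockSplit m (N a *ᵥ w)).1 ⬝ᵥ (blockSplit m (M a *ᵥ x)).1 +
        (blockSplit m (N a *ᵥ w)).2.1 ⬝ᵥ (blockSplit m (M a *ᵥ x)).2.1 +
        (blockSplit m (N a *ᵥ w)).2.2 ⬝ᵥ (blockSplit m (M a *ᵥ x)).2.2
      rw [← dotProduct_blockSplit, ← Matrix.vecMul_transpose, ← Matrix.dotProduct_mulVec,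
        Matrix.mulVec_mulVec, hNM, Matrix.one_mulVec])
    α β
  exact ⟨H, {u | DecodingFails q₁ (π₁ a) u}, {u | DecodingFails q₂ (π₂ a) u}, hH,
    fun q h1 h2 => hH' q (hα _ h1) (hβ _ h2), ha⟩

/-! ### Marginal error distributions and the hashing error -/

theorem sum_prod_fst_mul {J : Type} [Fintype J] [DecidableEq J] (p : ZMod 2 × ZMod 2 → ℝ)
    (f : (J → ZMod 2) → ℝ) :
    ∑ e : J → ZMod 2 × ZMod 2, (∏ i, p (e i)) * f (fun i => (e i).1) =
      ∑ u : J → ZMod 2, (∏ i, ∑ b, p (u i, b)) * f u := by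
  rw [← (Equiv.arrowProdEquivProdArrow J (fun _ => ZMod 2) (fun _ => ZMod 2)).symm.sum_comp,
    Fintype.sum_prod_type]
  refine Finset.sum_congr rfl fun u _ => ?_
  rw [Finset.prod_univ_sum, Fintype.piFinset_univ, Finset.sum_mul]
  rfl

theorem sum_prod_snd_mul {J : Type} [Fintype J] [DecidableEq J] (p : ZMod 2 × ZMod 2 → ℝ)
    (f : (J → ZMod 2) → ℝ) :
    ∑ e : J → ZMod 2 × ZMod 2, (∏ i, p (e i)) * f (fun i => (e i).2) =
      ∑ u : J → ZMod 2, (∏ i, ∑ b, p (b, u i)) * f u := by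
  rw [← (Equiv.arrowProdEquivProdArrow J (fun _ => ZMod 2) (fun _ => ZMod 2)).symm.sum_comp,
    Fintype.sum_prod_type_right]
  refine Finset.sum_congr rfl fun u _ => ?_
  rw [Finset.prod_univ_sum, Fintype.piFinset_univ, Finset.sum_mul]
  rfl

/-- The sum factorises as (√r₀ + √r₁)^(3m), and 1.1⁶ < 9/5. What matters is a base below 2, since
the code gains a factor 2^(-m). -/
theorem sum_sqrt_prod_sq_le {m : ℕ} {r : ZMod 2 → ℝ} (h0 : ∀ a, 0 ≤ r a) (hr0 : r 0 ≤ 1)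
    (hr1 : r 1 ≤ 1 / 100) :
    (∑ u : Blocks m → ZMod 2, √(∏ i, r (u i))) ^ 2 ≤ (9 / 5) ^ m := by
  have h1 : ∑ u : Blocks m → ZMod 2, √(∏ i, r (u i)) =
      (√(r 0) + √(r 1)) ^ (m + (m + m)) := by
    have := Finset.prod_univ_sum (fun _ : Blocks m =>
      (Finset.univ : Finset (ZMod 2))) fun _ a => √(r a)
    rw [Fintype.piFinset_univ, Finset.prod_const, Finset.card_univ, sum_zmod_two] at this
    simp only [Fintype.card_sum, Fintype.card_fin] at this
    rw [this]
    exact Finset.sum_congr rfl fun u _ => Real.sqrt_prod _ fun i _ => h0 _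
  have h2 : √(r 0) + √(r 1) ≤ 11 / 10 := by
    have e0 : √(r 0) ≤ 1 := Real.sqrt_le_one.mpr hr0
    have e1 : √(r 1) ≤ 1 / 10 := Real.sqrt_le_iff.mpr ⟨by norm_num, by linarith⟩
    linarith
  rw [h1, ← pow_mul, show (m + (m + m)) * 2 = 6 * m by ring, pow_mul]
  refine pow_le_pow_left₀ (by positivity) ?_ m
  calc _ ≤ (11 / 10 : ℝ) ^ 6 := pow_le_pow_left₀ (by positivity) h2 6
    _ ≤ 9 / 5 := by norm_num

open Classical in
/-- Hashing of Bell diagonal states with little noise, at the rate `1 / 3`. -/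
theorem exists_isLOCC_hash_bellDiagonal {m : ℕ} (hm : 0 < m) {p : ZMod 2 × ZMod 2 → ℝ}
    (hp : ∀ e, 0 ≤ p e) (hsum : ∑ e, p e = 1) (hp0 : 99 / 100 ≤ p 0) :
    ∃ H : Matrix ((Blocks m → ZMod 2) × (Blocks m → ZMod 2))
          ((Blocks m → ZMod 2) × (Blocks m → ZMod 2)) ℂ →
        Matrix ((Fin m → ZMod 2) × (Fin m → ZMod 2)) ((Fin m → ZMod 2) × (Fin m → ZMod 2)) ℂ,
      IsLOCC H ∧ traceDist (H (pairPower _ (∑ e, (p e : ℂ) • bellPair e)))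
        (maxEntangled (Fin m → ZMod 2)) ≤ 2 * (9 / 10) ^ m := by
  have h4 := hsum
  rw [Fintype.sum_prod_type, sum_zmod_two, sum_zmod_two, sum_zmod_two] at h4
  have hp0' : 99 / 100 ≤ p (0, 0) := hp0
  set r₁ : ZMod 2 → ℝ := fun a => ∑ b, p (a, b) with hr₁
  set r₂ : ZMod 2 → ℝ := fun a => ∑ b, p (b, a) with hr₂
  have hr₁0 : ∀ a, 0 ≤ r₁ a := fun a => Finset.sum_nonneg fun b _ => hp _
  have hr₂0 : ∀ a, 0 ≤ r₂ a := fun a => Finset.sum_nonneg fun b _ => hp _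
  have b00 := hp (0, 0)
  have b01 := hp (0, 1)
  have b10 := hp (1, 0)
  have b11 := hp (1, 1)
  have s₁ := sum_sqrt_prod_sq_le (m := m) hr₁0
    (by rw [hr₁]; simp only [sum_zmod_two]; linarith)
    (by rw [hr₁]; simp only [sum_zmod_two]; linarith)
  have s₂ := sum_sqrt_prod_sq_le (m := m) hr₂0
    (by rw [hr₂]; simp only [sum_zmod_two]; linarith)
    (by rw [hr₂]; simp only [sum_zmod_two]; linarith)
  obtain ⟨H, F₁, F₂, hH, hgood, herr⟩ := exists_isLOCC_hash_code hm
    (fun u => ∏ i, r₁ (u i)) (fun u => ∏ i, r₂ (u i))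
    (fun u => Finset.prod_nonneg fun i _ => hr₁0 _) (fun u => Finset.prod_nonneg fun i _ => hr₂0 _)
  refine ⟨H, hH, ?_⟩
  set P : (Blocks m → ZMod 2 × ZMod 2) → ℝ := fun e => ∏ i, p (e i) with hP
  have hP0 : ∀ e, 0 ≤ P e := fun e => Finset.prod_nonneg fun i _ => hp _
  set bad : (Blocks m → ZMod 2 × ZMod 2) → Prop :=
    fun e => (fun i => (e i).1) ∈ F₁ ∨ (fun i => (e i).2) ∈ F₂ with hbad
  set b : (Blocks m → ZMod 2 × ZMod 2) → Matrix ((Blocks m → ZMod 2) × (Blocks m → ZMod 2)) _ ℂ :=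
    fun e => bellState (Blocks m) (fun i => (e i).1, fun i => (e i).2) with hb
  set Q : ℝ := ∑ e, if bad e then P e else 0 with hQ
  have hQ0 : 0 ≤ Q := Finset.sum_nonneg fun e _ => by split_ifs <;> simp [hP0]
  have hQle : Q ≤ 2 * (9 / 10) ^ m := by
    have e₁ := sum_prod_fst_mul (J := Blocks m) p fun u => if u ∈ F₁ then 1 else 0
    have e₂ := sum_prod_snd_mul (J := Blocks m) p fun u => if u ∈ F₂ then 1 else 0
    simp only [mul_ite, mul_one, mul_zero] at e₁ e₂
    calc Q ≤ ∑ e, ((if (fun i => (e i).1) ∈ F₁ then P e else 0) +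
          (if (fun i => (e i).2) ∈ F₂ then P e else 0)) := by
          refine Finset.sum_le_sum fun e _ => ?_
          have := hP0 e
          by_cases h1 : (fun i => (e i).1) ∈ F₁ <;> by_cases h2 : (fun i => (e i).2) ∈ F₂ <;>
            simp [hbad, h1, h2, this]
      _ ≤ ((∑ u : Blocks m → ZMod 2, √(∏ i, r₁ (u i))) ^ 2 +
          (∑ u : Blocks m → ZMod 2, √(∏ i, r₂ (u i))) ^ 2) / 2 ^ m := by
          rw [Finset.sum_add_distrib, e₁, e₂]
          exact herr
      _ ≤ ((9 / 5) ^ m + (9 / 5) ^ m) / 2 ^ m := by gcongr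
      _ = 2 * (9 / 10) ^ m := by
          rw [← two_mul, mul_div_assoc, ← div_pow]
          norm_num
  have hPsum : ∑ e, P e = 1 := by
    have := Finset.prod_univ_sum (fun _ : Blocks m => (Finset.univ : Finset (ZMod 2 × ZMod 2)))
      fun _ e => p e
    rw [Fintype.piFinset_univ, Finset.prod_const, hsum, one_pow] at this
    exact this.symm
  set B := ∑ e, (if bad e then P e else 0) • b e with hB
  have hBpos : B.PosSemidef := Matrix.posSemidef_sum _ fun e _ =>
    posSemidef_real_smul (bellState_posSemidef _) (by split_ifs <;> simp [hP0])
  have hBtr : B.trace.re = Q := by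
    rw [hB, Matrix.trace_sum]
    simp only [Matrix.trace_smul, hb, bellState_trace, Complex.re_sum, Complex.real_smul, mul_one,
      Complex.ofReal_re, hQ]
  -- Good error strings give the maximally entangled state exactly and cancel. What is left has
  -- trace norm at most 2Q, hence trace distance at most Q.
  have hdecomp : H (pairPower (Blocks m) (∑ e, (p e : ℂ) • bellPair e)) -
      maxEntangled (Fin m → ZMod 2) = H B - Q • maxEntangled (Fin m → ZMod 2) := by
    have hlin : ∀ (c : (Blocks m → ZMod 2 × ZMod 2) → ℝ), H (∑ e, c e • b e) = ∑ e, c e • H (b e) := by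
      intro c
      rw [hH.map_sum]
      refine Finset.sum_congr rfl fun e _ => ?_
      rw [← Complex.coe_smul, hH.isLinearMap.map_smul, Complex.coe_smul]
    have h1 : pairPower (Blocks m) (∑ e, (p e : ℂ) • bellPair e) = ∑ e, P e • b e := by
      rw [pairPower_sum_bellPair]
      refine Finset.sum_congr rfl fun e _ => ?_
      rw [← Complex.ofReal_prod, Complex.coe_smul]
    have h2 : maxEntangled (Fin m → ZMod 2) = ∑ e, P e • maxEntangled (Fin m → ZMod 2) := by
      rw [← Finset.sum_smul, hPsum, one_smul]
    rw [h1, hlin, hB, hlin, hQ, Finset.sum_smul]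
    nth_rw 1 [h2]
    rw [← Finset.sum_sub_distrib, ← Finset.sum_sub_distrib]
    refine Finset.sum_congr rfl fun e _ => ?_
    by_cases h : bad e
    · rw [if_pos h]
    · rw [if_neg h, zero_smul, zero_smul, sub_zero]
      have h' := not_or.mp h
      rw [hb, hgood _ h'.1 h'.2, sub_self]
  rw [traceDist, hdecomp]
  have := traceNorm_sub_le (hH.posSemidef hBpos)
    (posSemidef_real_smul (maxEntangled_posSemidef (U := Fin m → ZMod 2)) hQ0)
  rw [hH.trace_eq, hBtr, Matrix.trace_smul, maxEntangled_trace, Complex.real_smul, mul_one,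
    Complex.ofReal_re] at this
  linarith

end Distillation

/-! ## A criterion for distillability -/

section Criterion

variable {X Y : Type} [Fintype X] [DecidableEq X] [Fintype Y] [DecidableEq Y]

theorem trace_eq_re {n : Type} [Fintype n] {P Q : Matrix n n ℂ} (hP : P.PosSemidef)
    (hQ : Q.PosSemidef) : (((P * Q).trace.re : ℝ) : ℂ) = (P * Q).trace :=
  Complex.ext rfl (Complex.le_def.mp (trace_mul_nonneg hP hQ)).2

theorem bellPair_zero : bellPair 0 = maxEntangled (ZMod 2) := by
  ext i j
  simp [bellPair, maxEntangled, sgn_zero, ZMod.card, eq_comm]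

/-- Surplus copies are discarded, the rest is grouped into 3m blocks of n, each block is mapped to
one twirled pair, and the pairs are hashed. -/
theorem exists_isLOCC_of_overlap {τ : Matrix (X × Y) (X × Y) ℂ} (hτ : IsDensity τ) {n : ℕ}
    {Λ : Matrix ((Fin n → X) × (Fin n → Y)) ((Fin n → X) × (Fin n → Y)) ℂ →
      Matrix (ZMod 2 × ZMod 2) (ZMod 2 × ZMod 2) ℂ} (hΛ : IsLOCC Λ)
    (hov : 99 / 100 ≤ ((Λ (tensorPow₂ τ n) * maxEntangled (ZMod 2)).trace).re)
    {N m : ℕ} (hm : 0 < m) (hN : 3 * m * n ≤ N) :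
    ∃ Ξ : Matrix ((Fin N → X) × (Fin N → Y)) ((Fin N → X) × (Fin N → Y)) ℂ →
        Matrix ((Fin m → ZMod 2) × (Fin m → ZMod 2)) ((Fin m → ZMod 2) × (Fin m → ZMod 2)) ℂ,
      IsLOCC Ξ ∧ traceDist (Ξ (tensorPow₂ τ N)) (maxEntangled (Fin m → ZMod 2)) ≤
        2 * (9 / 10) ^ m := by
  obtain ⟨T, hT, hT'⟩ := exists_isLOCC_twirl
  have hpow : IsDensity (pairPower (Fin n) τ) := pairPower_isDensity (Fin n) hτ
  set ω := Λ (pairPower (Fin n) τ) with hω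
  have hωd : IsDensity ω := hΛ.isDensity hpow
  set p : ZMod 2 × ZMod 2 → ℝ := fun e => (ω * bellPair e).trace.re with hp
  have hpe : ∀ e, ((p e : ℝ) : ℂ) = (ω * bellPair e).trace := fun e =>
    trace_eq_re hωd.1 (bellPair_posSemidef e)
  have hp0 : ∀ e, 0 ≤ p e := fun e =>
    (Complex.le_def.mp (trace_mul_nonneg hωd.1 (bellPair_posSemidef e))).1
  have hTω : T ω = ∑ e, (p e : ℂ) • bellPair e := by
    rw [hT']
    exact Finset.sum_congr rfl fun e _ => by rw [hpe]
  have hsum : ∑ e, p e = 1 := by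
    have h := hT.trace_eq ω
    rw [hωd.2, hTω, Matrix.trace_sum] at h
    simp only [Matrix.trace_smul, bellPair_trace, smul_eq_mul, mul_one] at h
    exact_mod_cast h
  obtain ⟨H, hH, hH'⟩ := exists_isLOCC_hash_bellDiagonal hm hp0 hsum
    (by rw [hp]; simp only [bellPair_zero]; exact hov)
  obtain ⟨Ξ₁, hΞ₁, h₁⟩ := exists_isLOCC_pairPower (hT.comp hΛ) (Blocks m)
  obtain ⟨Ξ₂, hΞ₂, h₂⟩ := exists_isLOCC_pairPower_prod (X := X) (Y := Y) (Blocks m) (Fin n)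
  have hcard : Fintype.card ((Blocks m × Fin n) ⊕ Fin (N - 3 * m * n)) = Fintype.card (Fin N) := by
    simp only [Fintype.card_sum, Fintype.card_prod, Fintype.card_fin]
    have : (m + (m + m)) * n = 3 * m * n := by ring
    omega
  obtain ⟨Ξ₃, hΞ₃, h₃⟩ := exists_isLOCC_pairPower_of_sum (X := X) (Y := Y)
    (Fintype.equivOfCardEq hcard)
  refine ⟨_, hH.comp (hΞ₁.comp (hΞ₂.comp hΞ₃)), ?_⟩
  have h := h₃ τ hτ
  have e : tensorPow₂ τ N = pairPower (Fin N) τ := rfl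
  rw [e, h, h₂, h₁, ← hω, hTω]
  exact hH'

theorem isDistillationRate_of_overlap {τ : Matrix (X × Y) (X × Y) ℂ} (hτ : IsDensity τ) {n : ℕ}
    (hn : 0 < n) {Λ : Matrix ((Fin n → X) × (Fin n → Y)) ((Fin n → X) × (Fin n → Y)) ℂ →
      Matrix (Fin 2 × Fin 2) (Fin 2 × Fin 2) ℂ} (hΛ : IsLOCC Λ)
    (hov : 99 / 100 ≤ ((Λ (tensorPow₂ τ n) * maxEntangled (Fin 2)).trace).re) :
    IsDistillationRate τ (3 * n : ℝ≥0)⁻¹ := by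
  set r : ℝ≥0 := (3 * n : ℝ≥0)⁻¹ with hr
  have hr0 : 0 < r := by positivity
  have hfloor : ∀ N : ℕ, 3 * ⌊N * r⌋₊ * n ≤ N := by
    intro N
    have h1 : (⌊N * r⌋₊ : ℝ≥0) ≤ N * r := Nat.floor_le (by positivity)
    have h2 : (3 * ⌊N * r⌋₊ * n : ℝ≥0) ≤ N := by
      calc (3 * ⌊N * r⌋₊ * n : ℝ≥0) = ⌊N * r⌋₊ * (3 * n) := by ring
        _ ≤ N * r * (3 * n) := by gcongr
        _ = N := by rw [hr]; field_simp
    exact_mod_cast h2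
  have key : ∀ N : ℕ, ∃ Ξ : Matrix ((Fin N → X) × (Fin N → Y)) ((Fin N → X) × (Fin N → Y)) ℂ →
      Matrix ((Fin ⌊N * r⌋₊ → Fin 2) × (Fin ⌊N * r⌋₊ → Fin 2))
        ((Fin ⌊N * r⌋₊ → Fin 2) × (Fin ⌊N * r⌋₊ → Fin 2)) ℂ,
      IsLOCC Ξ ∧ (0 < ⌊N * r⌋₊ → traceDist (Ξ (tensorPow₂ τ N))
        (maxEntangled (Fin ⌊N * r⌋₊ → Fin 2)) ≤ 2 * (9 / 10) ^ ⌊N * r⌋₊) := by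
    intro N
    -- Hashing needs m > 0. With no output pairs any LOCC map will do, as only large N matter for
    -- the limit.
    rcases Nat.eq_zero_or_pos ⌊N * r⌋₊ with h | h
    · have : IsEmpty (Fin ⌊N * r⌋₊) := by rw [h]; infer_instance
      exact ⟨_, IsLOCC.discard (Equiv.uniqueProd _ _).symm (Equiv.uniqueProd _ _).symm,
        fun h' => absurd h h'.ne'⟩
    · obtain ⟨Ξ, h1, h2⟩ := exists_isLOCC_of_overlap hτ hΛ hov h (hfloor N)
      exact ⟨Ξ, h1, fun _ => h2⟩
  choose Ξ hΞ hb using key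
  refine ⟨Ξ, hΞ, ?_⟩
  have hktop : Tendsto (fun N : ℕ => ⌊N * r⌋₊) atTop atTop :=
    tendsto_nat_floor_atTop.comp (tendsto_natCast_atTop_atTop.atTop_mul_const hr0)
  have hlim : Tendsto (fun N : ℕ => 2 * (9 / 10 : ℝ) ^ ⌊N * r⌋₊) atTop (𝓝 0) := by
    have := ((tendsto_pow_atTop_nhds_zero_of_lt_one (r := (9 / 10 : ℝ)) (by norm_num)
      (by norm_num)).comp hktop).const_mul 2
    simpa using this
  refine squeeze_zero' (Eventually.of_forall fun N => ?_) ?_ hlim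
  · exact div_nonneg (Complex.le_def.mp (msqrt_posSemidef _).trace_nonneg).1 zero_le_two
  · filter_upwards [hktop.eventually_gt_atTop 0] with N hN
    have := hb N hN
    rwa [← pairPower_phiPlus] at this

/-- Discarding a part of a maximally entangled system does not decrease the overlap. -/
theorem overlap_le_overlap_discard {U V S : Type} [Fintype U] [DecidableEq U] [Fintype V]
    [DecidableEq V] [Nonempty V] [Fintype S] [DecidableEq S] [Nonempty S] (e : U ≃ V × S)
    {ω : Matrix (U × U) (U × U) ℂ} (hω : ω.PosSemidef) :
    (ω * maxEntangled U).trace.re ≤ ((Matrix.of fun i j : V × V =>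
      ∑ s, ∑ t, ω (e.symm (i.1, s), e.symm (i.2, t)) (e.symm (j.1, s), e.symm (j.2, t))) *
        maxEntangled V).trace.re := by
  -- The compression of ω by the maximally entangled vector of the kept part. Up to the common
  -- factor 1/|V|, the overlap is Tr(GΦ) before discarding and Tr G after it.
  set G : Matrix (S × S) (S × S) ℂ := Matrix.of fun p q => ∑ v, ∑ v',
    ω (e.symm (v, p.1), e.symm (v, p.2)) (e.symm (v', q.1), e.symm (v', q.2)) with hG
  have hGpos : G.PosSemidef := by
    have := (hω.submatrix fun x : V × (S × S) =>
      (e.symm (x.1, x.2.1), e.symm (x.1, x.2.2))).conjTranspose_mul_mul_same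
      (Matrix.of fun (x : V × (S × S)) (p : S × S) => if x.2 = p then (1 : ℂ) else 0)
    convert this using 1
    ext p q
    simp only [hG, Matrix.of_apply, Matrix.mul_apply, Matrix.conjTranspose_apply,
      Fintype.sum_prod_type_right (α₁ := V), Matrix.submatrix_apply, apply_ite star, star_one,
      star_zero, ite_mul, one_mul, zero_mul, mul_ite, mul_one, mul_zero]
    rw [Finset.sum_comm]
    simp
  have h1 : ((Matrix.of fun i j : V × V =>
      ∑ s, ∑ t, ω (e.symm (i.1, s), e.symm (i.2, t)) (e.symm (j.1, s), e.symm (j.2, t))) *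
        maxEntangled V).trace = (Fintype.card V : ℂ)⁻¹ * G.trace := by
    rw [trace_mul_maxEntangled]
    congr 1
    simp only [Matrix.of_apply, Matrix.trace, Matrix.diag, hG, Fintype.sum_prod_type]
    calc _ = ∑ v, ∑ s, ∑ v', ∑ t, ω (e.symm (v, s), e.symm (v, t))
          (e.symm (v', s), e.symm (v', t)) := Finset.sum_congr rfl fun _ _ => Finset.sum_comm
      _ = ∑ s, ∑ v, ∑ t, ∑ v', ω (e.symm (v, s), e.symm (v, t))
          (e.symm (v', s), e.symm (v', t)) := by
          rw [Finset.sum_comm]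
          exact Finset.sum_congr rfl fun _ _ => Finset.sum_congr rfl fun _ _ => Finset.sum_comm
      _ = _ := Finset.sum_congr rfl fun _ _ => Finset.sum_comm
  have h2 : (ω * maxEntangled U).trace = (Fintype.card V : ℂ)⁻¹ * (G * maxEntangled S).trace := by
    rw [trace_mul_maxEntangled, trace_mul_maxEntangled, Fintype.card_congr e, Fintype.card_prod,
      ← mul_assoc, Nat.cast_mul, mul_inv]
    congr 1
    rw [← e.symm.sum_comp, Fintype.sum_prod_type_right]
    refine Finset.sum_congr rfl fun s _ => ?_
    simp only [hG, Matrix.of_apply]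
    refine (Finset.sum_congr rfl fun v _ => ?_).trans Finset.sum_comm
    rw [← e.symm.sum_comp, Fintype.sum_prod_type_right]
  have h3 := (Complex.le_def.mp (trace_mul_nonneg hGpos (one_sub_maxEntangled_posSemidef
    (U := S)))).1
  rw [Matrix.mul_sub, Matrix.mul_one, Matrix.trace_sub, Complex.sub_re, Complex.zero_re] at h3
  have hc : ((Fintype.card V : ℂ)⁻¹ : ℂ) = ((Fintype.card V : ℝ)⁻¹ : ℝ) := by push_cast; rfl
  rw [h1, h2, hc, Complex.re_ofReal_mul, Complex.re_ofReal_mul]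
  exact mul_le_mul_of_nonneg_left (by linarith) (by positivity)

/-! ### Distillability as an open condition -/

theorem exists_isDistillationRate {τ : Matrix (X × Y) (X × Y) ℂ}
    (h : 0 < distillableEntanglement τ) : ∃ r : ℝ≥0, 0 < r ∧ IsDistillationRate τ r := by
  rw [distillableEntanglement] at h
  obtain ⟨r, hr⟩ := lt_iSup_iff.mp h
  obtain ⟨hrate, hr'⟩ := lt_iSup_iff.mp hr
  exact ⟨r, by exact_mod_cast hr', hrate⟩

theorem distillableEntanglement_pos {τ : Matrix (X × Y) (X × Y) ℂ} {r : ℝ≥0} (hr : 0 < r)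
    (h : IsDistillationRate τ r) : 0 < distillableEntanglement τ :=
  lt_of_lt_of_le (by exact_mod_cast hr) (le_iSup₂ (f := fun (r : ℝ≥0) (_ : IsDistillationRate τ r) =>
    (r : ℝ≥0∞)) r h)

/-- From a distillable state one can obtain a single pair of qubits with a large overlap with the
maximally entangled state. -/
theorem exists_overlap_of_distillable {τ : Matrix (X × Y) (X × Y) ℂ} (hτ : IsDensity τ)
    (h : 0 < distillableEntanglement τ) :
    ∃ (n : ℕ) (Λ : Matrix ((Fin n → X) × (Fin n → Y)) ((Fin n → X) × (Fin n → Y)) ℂ →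
      Matrix (Fin 2 × Fin 2) (Fin 2 × Fin 2) ℂ), 0 < n ∧ IsLOCC Λ ∧
      99 / 100 < ((Λ (tensorPow₂ τ n) * maxEntangled (Fin 2)).trace).re := by
  obtain ⟨r, hr, Λ, hΛ, hlim⟩ := exists_isDistillationRate h
  have hktop : Tendsto (fun N : ℕ => ⌊N * r⌋₊) atTop atTop :=
    tendsto_nat_floor_atTop.comp (tendsto_natCast_atTop_atTop.atTop_mul_const hr)
  -- A trace distance below 1/200 costs less than 1/100 of overlap, by `one_sub_re_overlap_le`.
  obtain ⟨n, ⟨hk, hd⟩, hn⟩ := (((hktop.eventually_gt_atTop 0).and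
    (hlim.eventually_lt_const (by norm_num : (0 : ℝ) < 1 / 200))).and
    (eventually_gt_atTop 0)).exists
  have hdens : IsDensity (Λ n (tensorPow₂ τ n)) :=
    (hΛ n).isDensity (pairPower_isDensity (Fin n) hτ)
  have e₁ := one_sub_re_overlap_le hdens
  rw [← pairPower_phiPlus] at e₁
  have e₂ : traceDist (Λ n (tensorPow₂ τ n)) (pairPower (Fin ⌊n * r⌋₊) phiPlus) < 1 / 200 := hd
  let e := Equiv.funSplitAt (⟨0, hk⟩ : Fin ⌊n * r⌋₊) (Fin 2)
  have e₃ := overlap_le_overlap_discard e hdens.1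
  rw [← pairPower_phiPlus] at e₃
  exact ⟨n, _, hn, (IsLOCC.discard e e).comp (hΛ n), by linarith⟩

/-- Distillability is an open property of states. -/
theorem eventually_distillable {τ : Matrix (X × Y) (X × Y) ℂ} (hτ : IsDensity τ)
    (h : 0 < distillableEntanglement τ) :
    ∀ᶠ σ in 𝓝 τ, IsDensity σ → 0 < distillableEntanglement σ := by
  obtain ⟨n, Λ, hn, hΛ, hov⟩ := exists_overlap_of_distillable hτ h
  -- n and Λ stay fixed while the state varies, so the overlap is a polynomial in the entries of the
  -- state.
  let f : Matrix ((Fin n → X) × (Fin n → Y)) ((Fin n → X) × (Fin n → Y)) ℂ →ₗ[ℂ] ℂ :=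
    Matrix.traceLinearMap _ ℂ ℂ ∘ₗ LinearMap.mulRight ℂ (maxEntangled (Fin 2)) ∘ₗ
      hΛ.isLinearMap.mk'
  have hf : Continuous f := f.continuous_of_finiteDimensional
  have hpow : Continuous fun σ : Matrix (X × Y) (X × Y) ℂ => tensorPow₂ σ n := by
    refine continuous_matrix fun i j => ?_
    simp only [tensorPow₂, Matrix.of_apply]
    exact continuous_finsetProd _ fun k _ => continuous_apply_apply _ _
  have hc : Continuous fun σ : Matrix (X × Y) (X × Y) ℂ => (f (tensorPow₂ σ n)).re :=
    Complex.continuous_re.comp (hf.comp hpow)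
  filter_upwards [hc.continuousAt.eventually_const_lt hov] with σ hσ hdens
  exact distillableEntanglement_pos (by positivity)
    (isDistillationRate_of_overlap hdens hn hΛ hσ.le)

end Criterion

/-! ## The main theorem -/

section Main

/-- The witness states with little noise are distillable in the bipartition `A : BC`. -/
theorem witnessState_distillable {p : ℝ} (hd : IsDensity (witnessState p)) (hp : p ≤ 1 / 100) :
    0 < distillableEntanglement (witnessState p) := by
  let e : (Fin 1 → Fin 2) ≃ Fin 2 × Unit :=
    (Equiv.funUnique (Fin 1) (Fin 2)).trans (Equiv.prodUnique _ _).symm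
  let f : (Fin 1 → Fin 2 × Fin 2) ≃ Fin 2 × Fin 2 := Equiv.funUnique (Fin 1) (Fin 2 × Fin 2)
  -- A single copy suffices: once C is discarded, the overlap is 1 - 3p/4.
  refine distillableEntanglement_pos (r := (3 * (1 : ℕ))⁻¹) (by positivity)
    (isDistillationRate_of_overlap hd one_pos (IsLOCC.discard e f) ?_)
  rw [trace_mul_maxEntangled]
  simp [tensorPow₂, e, f, witnessState, phiPlus, Matrix.one_apply]
  linarith

theorem witnessState_mem (p : ℝ) :
    witnessState p ∈ hermitianTraceOne (Fin 2 × Fin 2 × Fin 2) :=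
  ⟨witnessState_isHermitian p, witnessState_trace p⟩

theorem witnessState_isDensity {p : ℝ} (h0 : 0 < p) (h1 : p ≤ 1) : IsDensity (witnessState p) :=
  cutABC_isDensity.mp (isDensity_isPPT_of_separable
    ((eventually_separable h0 h1).self_of_nhdsWithin (witnessState_mem p))).1

theorem eventually_vanishing {p : ℝ} (h0 : 0 < p) (h1 : p ≤ 1)
    (h : 0 < distillableEntanglement (witnessState p)) :
    ∀ᶠ σ in 𝓝[hermitianTraceOne (Fin 2 × Fin 2 × Fin 2)] (witnessState p),
      IsDensity σ ∧ logNegativity (cutABC σ) = 0 ∧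
      ENNReal.ofReal (logNegativity (cutABC σ)) < distillableEntanglement σ ∧
      HasAsymptoticFidelity σ 0 := by
  filter_upwards [eventually_separable h0 h1, nhdsWithin_le_nhds
    (eventually_distillable (witnessState_isDensity h0 h1) h)] with σ hσ hD
  obtain ⟨hd, hppt⟩ := isDensity_isPPT_of_separable hσ
  have hσd := cutABC_isDensity.mp hd
  have hD' := hD hσd
  have hlog := logNegativity_eq_zero hd.2 hppt
  obtain ⟨r, hr, hrate⟩ := exists_isDistillationRate hD'
  refine ⟨hσd, hlog, ?_, hasAsymptoticFidelity_zero hσd hppt hr hrate⟩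
  rwa [hlog, ENNReal.ofReal_zero]

/-- A set that contains a neighbourhood of a point in the affine space of Hermitian matrices of
trace one has nonzero measure. -/
theorem hasNonzeroMeasure_of_eventually {n : Type} [Fintype n] [DecidableEq n] [Nonempty n]
    {S : Set (Matrix n n ℂ)} {x : Matrix n n ℂ} (hx : x ∈ hermitianTraceOne n)
    (h : ∀ᶠ σ in 𝓝[hermitianTraceOne n] x, σ ∈ S) : HasNonzeroMeasure S := by
  intro ν _
  set c : Matrix n n ℂ := (Fintype.card n : ℂ)⁻¹ • (1 : Matrix n n ℂ) with hc
  have hcard : (Fintype.card n : ℂ) ≠ 0 := Nat.cast_ne_zero.mpr Fintype.card_ne_zero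
  have hctr : c.trace = 1 := by
    rw [hc, Matrix.trace_smul, Matrix.trace_one, smul_eq_mul, inv_mul_cancel₀ hcard]
  have hcherm : c.IsHermitian := by
    rw [hc, Matrix.IsHermitian, Matrix.conjTranspose_smul, Matrix.conjTranspose_one]
    simp
  let H₀ : tracelessHermitian n :=
    ⟨x - c, hx.1.sub hcherm, by rw [Matrix.trace_sub, hx.2, hctr, sub_self]⟩
  have hcont : Continuous fun H : tracelessHermitian n => c + (H : Matrix n n ℂ) :=
    continuous_const.add continuous_subtype_val
  have hmem : ∀ H : tracelessHermitian n, c + (H : Matrix n n ℂ) ∈ hermitianTraceOne n := fun H =>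
    ⟨hcherm.add H.2.1, by rw [Matrix.trace_add, hctr, H.2.2, add_zero]⟩
  have htend : Tendsto (fun H : tracelessHermitian n => c + (H : Matrix n n ℂ)) (𝓝 H₀)
      (𝓝[hermitianTraceOne n] x) := by
    refine tendsto_nhdsWithin_iff.mpr ⟨?_, Eventually.of_forall hmem⟩
    have := hcont.tendsto H₀
    rwa [show c + (H₀ : Matrix n n ℂ) = x from add_sub_cancel c x] at this
  -- The preimage of S is a neighbourhood of x - 𝟙/d, and a Haar measure is positive on
  -- neighbourhoods.
  exact (Measure.measure_pos_of_mem_nhds ν (htend.eventually h)).ne'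

end Main

end PQSM

theorem mainTheorem5 :
    -- the three-qubit states with vanishing asymptotic fidelity have nonzero measure
    PQSM.HasNonzeroMeasure
      {ρ : Matrix (Fin 2 × Fin 2 × Fin 2) (Fin 2 × Fin 2 × Fin 2) ℂ |
        PQSM.IsDensity ρ ∧ PQSM.HasAsymptoticFidelity ρ 0} ∧
    -- the witness states are distillable in the bipartition `A : BC` for all small `p > 0`
    (∃ pmax : ℝ, 0 < pmax ∧ pmax ≤ 1 ∧ ∀ p : ℝ, 0 < p → p < pmax →
      0 < PQSM.distillableEntanglement (PQSM.witnessState p)) ∧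
    ∀ p : ℝ, 0 < p → p ≤ 1 →
      -- they are states in the interior of the set of `AB : C`-separable states
      PQSM.IsDensity (PQSM.witnessState p) ∧
      (∀ᶠ σ in 𝓝[PQSM.hermitianTraceOne (Fin 2 × Fin 2 × Fin 2)] (PQSM.witnessState p),
        PQSM.cutABC σ ∈ PQSM.separableStates (Fin 2 × Fin 2) (Fin 2)) ∧
      -- if distillable, they have a neighbourhood of states for which the vanishing condition
      -- `D_LOCC^{A:BC} > E_n^{AB:C} = 0` holds and the asymptotic fidelity vanishes
      (0 < PQSM.distillableEntanglement (PQSM.witnessState p) →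
        ∀ᶠ σ in 𝓝[PQSM.hermitianTraceOne (Fin 2 × Fin 2 × Fin 2)] (PQSM.witnessState p),
          PQSM.IsDensity σ ∧
          PQSM.logNegativity (PQSM.cutABC σ) = 0 ∧
          ENNReal.ofReal (PQSM.logNegativity (PQSM.cutABC σ)) <
            PQSM.distillableEntanglement σ ∧
          PQSM.HasAsymptoticFidelity σ 0) := by
  have hdist : ∀ p : ℝ, 0 < p → p < 1 / 100 →
      0 < PQSM.distillableEntanglement (PQSM.witnessState p) := fun p h0 h1 =>
    PQSM.witnessState_distillable (PQSM.witnessState_isDensity h0 (by linarith)) h1.le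
  refine ⟨?_, ⟨1 / 100, by norm_num, by norm_num, hdist⟩, fun p h0 h1 =>
    ⟨PQSM.witnessState_isDensity h0 h1, PQSM.eventually_separable h0 h1,
      PQSM.eventually_vanishing h0 h1⟩⟩
  -- Any p strictly between 0 and 1/100 would serve.
  refine PQSM.hasNonzeroMeasure_of_eventually (PQSM.witnessState_mem (1 / 200)) ?_
  filter_upwards [PQSM.eventually_vanishing (by norm_num) (by norm_num)
    (hdist (1 / 200) (by norm_num) (by norm_num))] with σ hσ
  exact ⟨hσ.1, hσ.2.2.2⟩
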